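/- Let $\mathcal H_A,\mathcal H_B$ be finite-dimensional complex Hilbert spaces, let $\Phi,\Psi\in\mathcal H_A\otimes\mathcal H_B$ be unit vectors, and let $\rho=\mathrm{Tr}_B|\Phi\rangle\langle\Phi|$ and $\sigma=\mathrm{Tr}_B|\Psi\rangle\langle\Psi|$ be their reduced densities on $\mathcal H_A$. For density operators $\rho',\rho$ on $\mathcal H_A$ write $\rho'\succeq\rho$ if for every $k$ the sum of the $k$ largest eigenvalues (counted with multiplicity) of $\rho'$ is at least the sum of the $k$ largest eigenvalues of $\rho$. Call a quantum operation LOCC if it can be implemented by finitely many rounds in which one of the two parties performs a local quantum instrument with finitely many outcomes and announces the outcome, all later steps being allowed to depend on the announced outcomes. Then all of the following maxima exist, and $$\max_{C}\langle\Psi|C(|\Phi\rangle\langle\Phi|)|\Psi\rangle=\max_{\rho'\succeq\rho}\ \max_{U}\bigl|\mathrm{Tr}\,\sqrt{\rho'}\sqrt{\sigma}\,U\bigr|^2,$$ where $C$ runs over all LOCC operations on $\mathcal H_A\otimes\mathcal H_B$, $\rho'$ over the density operators on $\mathcal H_A$ with $\rho'\succeq\rho$, and $U$ over the unitary operators on $\mathcal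 H_A$. If moreover $\Psi$ is maximally entangled of size $L\ge1$, i.e. $T:=L\sigma$ is an orthogonal projection of rank $L$, then $$\max_{\rho'\succeq\rho}\ \max_{U}\bigl|\mathrm{Tr}\,\sqrt{\rho'}\sqrt{\sigma}\,U\bigr|^2=\max_{\rho'\succeq\rho}\frac{\bigl(\mathrm{Tr}\,\sqrt{\rho'}\,T\bigr)^2}{L}.$$ -/

import Mathlib

open scoped Matrix Kronecker ComplexOrder MatrixOrder

noncomputable section

namespace LOCCFidelity

/-- Operators on `ℂ^a ⊗ ℂ^b`, the joint system of Alice (first factor) and Bob (second factor). -/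
abbrev BipOp (a b : ℕ) : Type := Matrix (Fin a × Fin b) (Fin a × Fin b) ℂ

/-- Vectors of the Hilbert space `ℂ^a ⊗ ℂ^b`. -/
abbrev BipVec (a b : ℕ) : Type := EuclideanSpace ℂ (Fin a × Fin b)

/-- The operator `|Φ⟩⟨Φ|`. -/
def pureState {a b : ℕ} (Φ : BipVec a b) : BipOp a b :=
  Matrix.vecMulVec (fun x => Φ x) (fun x => star (Φ x))

/-- The partial trace over Bob's system. -/
def partialTraceB {a b : ℕ} (X : BipOp a b) : Matrix (Fin a) (Fin a) ℂ :=
  Matrix.of fun i i' => ∑ j, X (i, j) (i', j)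

/-- The reduced density `Tr_B |Φ⟩⟨Φ|`. -/
def reducedDensity {a b : ℕ} (Φ : BipVec a b) : Matrix (Fin a) (Fin a) ℂ :=
  partialTraceB (pureState Φ)

/-- The completely positive map on Alice's system with Kraus operators `K j`,
tensored with the identity on Bob's system. -/
def aliceMap {a b e l : ℕ} (K : Fin l → Matrix (Fin e) (Fin a) ℂ) (X : BipOp a b) : BipOp e b :=
  ∑ j, (K j ⊗ₖ (1 : Matrix (Fin b) (Fin b) ℂ)) * X * (K j ⊗ₖ (1 : Matrix (Fin b) (Fin b) ℂ))ᴴ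

/-- The completely positive map on Bob's system with Kraus operators `K j`,
tensored with the identity on Alice's system. -/
def bobMap {a b e l : ℕ} (K : Fin l → Matrix (Fin e) (Fin b) ℂ) (X : BipOp a b) : BipOp a e :=
  ∑ j, ((1 : Matrix (Fin a) (Fin a) ℂ) ⊗ₖ K j) * X * ((1 : Matrix (Fin a) (Fin a) ℂ) ⊗ₖ K j)ᴴ

/-- Quantum operations implementable by local operations and classical communication, with any
finite number of rounds: either nothing is done, or one party performs a local instrument (a finite
family of completely positive maps, the `k`-th with Kraus operators `K k j`, whose sum preserves
the trace), announces the outcome `k`, and the parties go on with an LOCC operation `C k` depending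
on `k`. The local dimensions may change at every step, so local ancillas may be added and
discarded. -/
inductive IsLOCC {a' b' : ℕ} : {a b : ℕ} → (BipOp a b → BipOp a' b') → Prop
  | refl : IsLOCC (a := a') (b := b') (fun X => X)
  | alice {a b m l : ℕ} (e : Fin m → ℕ)
      (K : (k : Fin m) → Fin l → Matrix (Fin (e k)) (Fin a) ℂ)
      (hK : ∑ k, ∑ j, (K k j)ᴴ * K k j = 1)
      (C : (k : Fin m) → BipOp (e k) b → BipOp a' b')
      (hC : ∀ k, IsLOCC (C k)) :
      IsLOCC (fun X : BipOp a b => ∑ k, C k (aliceMap (K k) X))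
  | bob {a b m l : ℕ} (e : Fin m → ℕ)
      (K : (k : Fin m) → Fin l → Matrix (Fin (e k)) (Fin b) ℂ)
      (hK : ∑ k, ∑ j, (K k j)ᴴ * K k j = 1)
      (C : (k : Fin m) → BipOp a (e k) → BipOp a' b')
      (hC : ∀ k, IsLOCC (C k)) :
      IsLOCC (fun X : BipOp a b => ∑ k, C k (bobMap (K k) X))

/-- The fidelity `⟨Ψ| X |Ψ⟩` (a real number for Hermitian `X`). -/
def fidelity {a b : ℕ} (Ψ : BipVec a b) (X : BipOp a b) : ℝ :=
  ((fun x => star (Ψ x)) ⬝ᵥ (X *ᵥ (fun x => Ψ x))).re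

/-- Density matrices. -/
def IsDensity {d : ℕ} (ρ : Matrix (Fin d) (Fin d) ℂ) : Prop :=
  ρ.PosSemidef ∧ ρ.trace = 1

/-- `ρ' ⪰ ρ`: for every `k`, the sum of the `k` largest eigenvalues (with multiplicity) of `ρ'` is
at least that of `ρ`. Mathlib's `eigenvalues₀` lists the eigenvalues in decreasing order. -/
def Majorizes {d : ℕ} (ρ' ρ : Matrix (Fin d) (Fin d) ℂ) : Prop :=
  ∃ (h' : ρ'.IsHermitian) (h : ρ.IsHermitian), ∀ k : ℕ,
    ∑ i with i.val < k, h.eigenvalues₀ i ≤ ∑ i with i.val < k, h'.eigenvalues₀ i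

/-- The set of density matrices `ρ'` with `ρ' ⪰ ρ`. -/
def majorizingDensities {d : ℕ} (ρ : Matrix (Fin d) (Fin d) ℂ) : Set (Matrix (Fin d) (Fin d) ℂ) :=
  {ρ' | IsDensity ρ' ∧ Majorizes ρ' ρ}

/-- `Ψ` is maximally entangled of size `L ≥ 1`: `L • Tr_B |Ψ⟩⟨Ψ|` is an orthogonal projection of
rank `L`. -/
def IsMaximallyEntangled {a b : ℕ} (Ψ : BipVec a b) (L : ℕ) : Prop :=
  0 < L ∧ IsStarProjection ((L : ℂ) • reducedDensity Ψ) ∧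
    ((L : ℂ) • reducedDensity Ψ).rank = L

end LOCCFidelity

end

/-!
Identify a vector of `ℂ^a ⊗ ℂ^b` with its coefficient matrix `M`. A local operator `A ⊗ B` sends
`M` to `A * M * Bᵀ`, the reduced density is `M * Mᴴ`, and the Schmidt coefficients are the singular
values of `M`.

An LOCC operation has product Kraus operators `A k ⊗ B k`. The squared singular values of the
matrices `A k * M * (B k)ᵀ` add up to a vector `p` majorizing those of `M`: by Eckart–Young, tail
sums of squared singular values are squared Hilbert–Schmidt distances to the matrices of bounded
rank, and local operators do not raise the rank. Von Neumann's trace inequality and Cauchy–Schwarz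
then bound the fidelity by `(∑ i, √(p i) * s i) ^ 2`, where `s` are the Schmidt coefficients of `Ψ`.

Conversely, by Rado's theorem the squared singular values of `M` are a convex combination of
permutations of any `p` majorizing them, and Nielsen's protocol turns this combination into a
measurement of Alice with corrections of Bob which attains the bound.

The spectra of the `ρ' ⪰ ρ` are exactly these vectors `p`. Von Neumann's inequality bounds
`|Tr √ρ' √σ U|` by `∑ i, √(p i) * s i`, with equality at `U = 1` when `ρ'` and `σ` have the same
eigenvectors in the same order. If `L • σ` is a projection then `√σ = √L • σ`.
-/

noncomputable section

namespace LOCCFidelity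

open Matrix

section PartialSums

variable {R : Type*} [CommRing R] [PartialOrder R] [IsOrderedRing R] {n : ℕ}

/-- Every initial partial sum of `x` is at most that of `y`. For decreasing vectors this is weak
majorization of `x` by `y`. -/
def PartialSumsLE (x y : Fin n → R) : Prop :=
  ∀ k : ℕ, ∑ i with i.val < k, x i ≤ ∑ i with i.val < k, y i

theorem mul_sum_le_dotProduct_of_partialSums_nonneg {x w : Fin n → R} {c : R} (hx : Antitone x)
    (hc : ∀ i, c ≤ x i) (hw : ∀ k : ℕ, 0 ≤ ∑ i with i.val < k, w i) :
    c * ∑ i, w i ≤ x ⬝ᵥ w := by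
  induction n generalizing c with
  | zero => simp
  | succ n ih =>
    have hw' (k : ℕ) : 0 ≤ ∑ i : Fin n with i.val < k, w i.castSucc := by
      have := hw (min k n)
      simpa [Finset.sum_filter, Fin.sum_univ_castSucc] using this
    have htotal : 0 ≤ ∑ i, w i := by
      simpa only [Fin.is_lt, Finset.filter_true] using hw (n + 1)
    calc c * ∑ i, w i ≤ x (Fin.last n) * ∑ i, w i :=
          mul_le_mul_of_nonneg_right (hc _) htotal
      _ = x (Fin.last n) * ∑ i : Fin n, w i.castSucc + x (Fin.last n) * w (Fin.last n) := by
          rw [Fin.sum_univ_castSucc, mul_add]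
      _ ≤ ∑ i : Fin n, x i.castSucc * w i.castSucc + x (Fin.last n) * w (Fin.last n) := by
          gcongr
          exact ih (hx.comp_monotone Fin.strictMono_castSucc.monotone)
            (fun i => hx (Fin.le_last _)) hw'
      _ = x ⬝ᵥ w := (Fin.sum_univ_castSucc fun i => x i * w i).symm

theorem PartialSumsLE.dotProduct_le {x y z : Fin n → R} (h : PartialSumsLE y z) (hx : Antitone x)
    (hx₀ : ∀ i, 0 ≤ x i) : x ⬝ᵥ y ≤ x ⬝ᵥ z := by
  have := mul_sum_le_dotProduct_of_partialSums_nonneg (w := z - y) hx hx₀ fun k => by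
    simpa using h k
  simpa [dotProduct_sub] using this

theorem PartialSumsLE.dotProduct_le_of_sum_eq {x y z : Fin n → ℝ} (h : PartialSumsLE y z)
    (hsum : ∑ i, y i = ∑ i, z i) (hx : Antitone x) : x ⬝ᵥ y ≤ x ⬝ᵥ z := by
  obtain ⟨c, hc⟩ := (Set.finite_range x).bddBelow
  have := mul_sum_le_dotProduct_of_partialSums_nonneg (w := z - y) hx
    (fun i => hc (Set.mem_range_self i)) fun k => by simpa using h k
  simpa [dotProduct_sub, hsum] using this

section Substochastic

variable {B : Matrix (Fin n) (Fin n) R}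

theorem partialSumsLE_sum_rows_indicator (hB : ∀ i j, 0 ≤ B i j) (hrow : ∀ i, ∑ j, B i j ≤ 1)
    (hcol : ∀ j, ∑ i, B i j ≤ 1) (k : ℕ) :
    PartialSumsLE (fun j => ∑ i with i.val < k, B i j) fun j => if j.val < k then 1 else 0 := by
  intro l
  rcases le_total l k with hlk | hkl
  · refine Finset.sum_le_sum fun j hj => ?_
    rw [if_pos ((Finset.mem_filter.1 hj).2.trans_le hlk)]
    exact (Finset.sum_le_univ_sum_of_nonneg fun i => hB i j).trans (hcol j)
  · calc ∑ j with j.val < l, ∑ i with i.val < k, B i j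
        = ∑ i with i.val < k, ∑ j with j.val < l, B i j := Finset.sum_comm
      _ ≤ ∑ i : Fin n with i.val < k, 1 := Finset.sum_le_sum fun i _ =>
          (Finset.sum_le_univ_sum_of_nonneg fun j => hB i j).trans (hrow i)
      _ = ∑ j : Fin n with j.val < l, if j.val < k then 1 else 0 := by
          rw [← Finset.sum_filter, Finset.filter_filter]
          congr! 2
          grind

theorem partialSumsLE_mulVec (hB : ∀ i j, 0 ≤ B i j) (hrow : ∀ i, ∑ j, B i j ≤ 1)
    (hcol : ∀ j, ∑ i, B i j ≤ 1) {y : Fin n → R} (hy : Antitone y) (hy₀ : ∀ i, 0 ≤ y i) :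
    PartialSumsLE (B *ᵥ y) y := by
  intro k
  calc ∑ i with i.val < k, (B *ᵥ y) i
      = y ⬝ᵥ fun j => ∑ i with i.val < k, B i j := by
        simp only [Matrix.mulVec, dotProduct, Finset.mul_sum, mul_comm]
        exact Finset.sum_comm
    _ ≤ y ⬝ᵥ fun j => if j.val < k then 1 else 0 :=
        (partialSumsLE_sum_rows_indicator hB hrow hcol k).dotProduct_le hy hy₀
    _ = ∑ i with i.val < k, y i := by simp [dotProduct, Finset.sum_filter]

theorem dotProduct_mulVec_le_of_substochastic (hB : ∀ i j, 0 ≤ B i j)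
    (hrow : ∀ i, ∑ j, B i j ≤ 1) (hcol : ∀ j, ∑ i, B i j ≤ 1) {x y : Fin n → R}
    (hx : Antitone x) (hx₀ : ∀ i, 0 ≤ x i) (hy : Antitone y) (hy₀ : ∀ i, 0 ≤ y i) :
    x ⬝ᵥ (B *ᵥ y) ≤ x ⬝ᵥ y :=
  (partialSumsLE_mulVec hB hrow hcol hy hy₀).dotProduct_le hx hx₀

end Substochastic

theorem exists_perm_dotProduct_le_of_partialSumsLE {p q : Fin n → ℝ} (h : PartialSumsLE q p)
    (hsum : ∑ i, q i = ∑ i, p i) (hq : Antitone q) (c : Fin n → ℝ) :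
    ∃ π : Equiv.Perm (Fin n), c ⬝ᵥ q ≤ c ⬝ᵥ (p ∘ π) := by
  obtain ⟨τ, hτ⟩ : ∃ τ : Equiv.Perm (Fin n), Antitone (c ∘ τ) :=
    ⟨Tuple.sort (-c), fun i j hij => by simpa using Tuple.monotone_sort (-c) hij⟩
  refine ⟨τ.symm, ?_⟩
  calc c ⬝ᵥ q = ∑ i, (c ∘ τ) i * q (τ i) := (Equiv.sum_comp τ fun i => c i * q i).symm
    _ ≤ (c ∘ τ) ⬝ᵥ q := (hτ.monovary hq).sum_mul_comp_perm_le_sum_mul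
    _ ≤ (c ∘ τ) ⬝ᵥ p := h.dotProduct_le_of_sum_eq hsum hτ
    _ = c ⬝ᵥ (p ∘ τ.symm) := comp_equiv_dotProduct_comp_equiv c (p ∘ τ.symm) τ ▸ by
          simp [Function.comp_assoc]

theorem mem_convexHull_perm_of_partialSumsLE {p q : Fin n → ℝ} (h : PartialSumsLE q p)
    (hsum : ∑ i, q i = ∑ i, p i) (hq : Antitone q) :
    q ∈ convexHull ℝ (Set.range fun π : Equiv.Perm (Fin n) => p ∘ π) := by
  by_contra hmem
  obtain ⟨f, u, hfu, huq⟩ := geometric_hahn_banach_closed_point (convex_convexHull ℝ _)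
    ((Set.finite_range _).isClosed_convexHull ℝ) hmem
  have hf (v : Fin n → ℝ) : f v = (fun i => f (Pi.single i 1)) ⬝ᵥ v := by
    conv_lhs => rw [pi_eq_sum_univ' v, map_sum]
    simp [dotProduct, mul_comm]
  obtain ⟨π, hπ⟩ := exists_perm_dotProduct_le_of_partialSumsLE h hsum hq fun i => f (Pi.single i 1)
  rw [← hf, ← hf] at hπ
  exact absurd (hfu _ (subset_convexHull ℝ _ ⟨π, rfl⟩)) (by linarith)

end PartialSums

theorem sum_sq_sum_sqrt_mul_le {ι κ : Type*} [Fintype ι] [Fintype κ] {r : ι → ℝ}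
    (hr : ∀ i, 0 ≤ r i) {l : κ → ι → ℝ} (hl : ∀ k i, 0 ≤ l k i) :
    ∑ k, (∑ i, √(l k i) * r i) ^ 2 ≤ (∑ i, √(∑ k, l k i) * r i) ^ 2 := by
  have hsq (v : ι → ℝ) : (∑ i, v i * r i) ^ 2 = ∑ i, ∑ j, v i * v j * (r i * r j) := by
    simp only [sq, Finset.sum_mul_sum, mul_mul_mul_comm]
  calc ∑ k, (∑ i, √(l k i) * r i) ^ 2
      = ∑ i, ∑ j, (∑ k, √(l k i) * √(l k j)) * (r i * r j) := by
        simp only [hsq, Finset.sum_mul]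
        rw [Finset.sum_comm]
        exact Finset.sum_congr rfl fun i _ => Finset.sum_comm
    _ ≤ ∑ i, ∑ j, √(∑ k, l k i) * √(∑ k, l k j) * (r i * r j) := by
        gcongr with i _ j _
        · exact mul_nonneg (hr i) (hr j)
        · exact Real.sum_sqrt_mul_sqrt_le _ (fun k => hl k i) fun k => hl k j
    _ = (∑ i, √(∑ k, l k i) * r i) ^ 2 := (hsq _).symm

section RealDiagonal

variable {𝕜 n : Type*} [RCLike 𝕜] [DecidableEq n]

/-- The diagonal matrix over `𝕜` with real diagonal entries `v`. -/
abbrev realDiagonal (𝕜 : Type*) [RCLike 𝕜] (v : n → ℝ) : Matrix n n 𝕜 :=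
  diagonal (RCLike.ofReal ∘ v)

theorem realDiagonal_mul_realDiagonal [Fintype n] (v w : n → ℝ) :
    realDiagonal 𝕜 v * realDiagonal 𝕜 w = realDiagonal 𝕜 (v * w) := by
  simp [diagonal_mul_diagonal]

theorem conjTranspose_realDiagonal (v : n → ℝ) : (realDiagonal 𝕜 v)ᴴ = realDiagonal 𝕜 v := by
  simp [diagonal_conjTranspose, Function.comp_def, Pi.star_def]

theorem trace_realDiagonal [Fintype n] (v : n → ℝ) :
    (realDiagonal 𝕜 v).trace = ((∑ i, v i : ℝ) : 𝕜) := by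
  simp [trace_diagonal]

theorem posSemidef_realDiagonal {v : n → ℝ} (hv : ∀ i, 0 ≤ v i) :
    (realDiagonal 𝕜 v).PosSemidef :=
  PosSemidef.diagonal fun i => RCLike.ofReal_nonneg.2 (hv i)

end RealDiagonal

section Contraction

open scoped Matrix.Norms.L2Operator

variable {𝕜 l m n : Type*} [RCLike 𝕜] [Fintype l] [Fintype m] [Fintype n] [DecidableEq n]

theorem sum_norm_sq_col_le_sq_l2_opNorm (Y : Matrix m n 𝕜) (j : n) :
    ∑ i, ‖Y i j‖ ^ 2 ≤ ‖Y‖ ^ 2 := by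
  have h := l2_opNorm_mulVec Y (EuclideanSpace.single j 1)
  rw [PiLp.norm_single, norm_one, mul_one] at h
  simpa [EuclideanSpace.norm_sq_eq] using pow_le_pow_left₀ (norm_nonneg _) h 2

theorem sum_norm_sq_row_le_sq_l2_opNorm (Y : Matrix m n 𝕜) (i : m) :
    ∑ j, ‖Y i j‖ ^ 2 ≤ ‖Y‖ ^ 2 := by
  classical
  rw [← l2_opNorm_conjTranspose]
  simpa using sum_norm_sq_col_le_sq_l2_opNorm Yᴴ i

theorem l2_opNorm_le_one_of_conjTranspose_mul_self_le_one {Y : Matrix m n 𝕜} (h : ‖Yᴴ * Y‖ ≤ 1) :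
    ‖Y‖ ≤ 1 := by
  rw [l2_opNorm_conjTranspose_mul_self] at h
  nlinarith [norm_nonneg Y]

theorem l2_opNorm_le_one_of_mem_unitaryGroup {U : Matrix n n 𝕜} (hU : U ∈ unitaryGroup n 𝕜) :
    ‖U‖ ≤ 1 := by
  cases isEmpty_or_nonempty n
  · simp [Subsingleton.elim U 0]
  · exact (CStarRing.norm_of_mem_unitary hU).le

theorem l2_opNorm_mul_le_one [DecidableEq m] {Y : Matrix l m 𝕜} {Z : Matrix m n 𝕜} (hY : ‖Y‖ ≤ 1)
    (hZ : ‖Z‖ ≤ 1) : ‖Y * Z‖ ≤ 1 :=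
  (l2_opNorm_mul Y Z).trans (mul_le_one₀ hY (norm_nonneg _) hZ)

theorem l2_opNorm_le_one_of_mul_conjTranspose_eq [DecidableEq m] {X : Matrix m n 𝕜} {e : m → ℝ}
    (he : ∀ i, ‖e i‖ ≤ 1) (h : X * Xᴴ = realDiagonal 𝕜 e) : ‖X‖ ≤ 1 := by
  rw [← l2_opNorm_conjTranspose]
  refine l2_opNorm_le_one_of_conjTranspose_mul_self_le_one ?_
  rw [conjTranspose_conjTranspose, h, l2_opNorm_diagonal, pi_norm_le_iff_of_nonneg zero_le_one]
  simpa using he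

theorem posSemidef_one_sub_conjTranspose_mul_self {Y : Matrix m n ℂ} (hY : ‖Y‖ ≤ 1) :
    (1 - Yᴴ * Y).PosSemidef := by
  have hY' : ‖Yᴴ * Y‖ ≤ 1 := by
    rw [l2_opNorm_conjTranspose_mul_self]
    exact mul_le_one₀ hY (norm_nonneg _) hY
  exact le_iff.1 ((CStarAlgebra.norm_le_one_iff_of_nonneg _
    (posSemidef_conjTranspose_mul_self Y).nonneg).1 hY')

theorem exists_kraus_completion [Nonempty m] {k : ℕ} {Y : Matrix m (Fin k) ℂ} (hY : ‖Y‖ ≤ 1) :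
    ∃ K : Fin (k + 1) → Matrix m (Fin k) ℂ, K 0 = Y ∧ ∑ r, (K r)ᴴ * K r = 1 := by
  classical
  obtain ⟨R, hR⟩ := CStarAlgebra.nonneg_iff_eq_star_mul_self.1
    (posSemidef_one_sub_conjTranspose_mul_self hY).nonneg
  obtain ⟨i₀⟩ := ‹Nonempty m›
  set E : Fin k → Matrix m (Fin k) ℂ := fun j => single i₀ j 1
  have hE : ∑ j, (E j)ᴴ * E j = 1 := by
    simp only [E, conjTranspose_single, star_one, single_mul_single_same, mul_one, sum_single_one]
  refine ⟨Fin.cons Y fun j => E j * R, rfl, ?_⟩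
  simp only [Fin.sum_univ_succ, Fin.cons_zero, Fin.cons_succ, conjTranspose_mul]
  calc Yᴴ * Y + ∑ j, Rᴴ * (E j)ᴴ * (E j * R)
      = Yᴴ * Y + Rᴴ * (∑ j, (E j)ᴴ * E j) * R := by
        simp only [Matrix.mul_sum, Matrix.sum_mul, Matrix.mul_assoc]
    _ = 1 := by
        rw [hE, Matrix.mul_one, ← star_eq_conjTranspose R, ← hR, add_sub_cancel]

theorem trace_realDiagonal_mul_mul (r s : n → ℝ) (A Z : Matrix n n 𝕜) :
    (realDiagonal 𝕜 r * A * realDiagonal 𝕜 s * Z).trace =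
      ∑ i, ∑ j, (r i : 𝕜) * A i j * (s j : 𝕜) * Z j i := by
  simp only [trace, diag_apply, mul_apply (N := Z), Matrix.mul_diagonal, Matrix.diagonal_mul,
    Function.comp_apply]

theorem norm_trace_realDiagonal_mul_mul_le {d : ℕ} {A Z : Matrix (Fin d) (Fin d) 𝕜}
    (hA : ‖A‖ ≤ 1) (hZ : ‖Z‖ ≤ 1) {r s : Fin d → ℝ} (hr : Antitone r) (hr₀ : ∀ i, 0 ≤ r i)
    (hs : Antitone s) (hs₀ : ∀ i, 0 ≤ s i) :
    ‖(realDiagonal 𝕜 r * A * realDiagonal 𝕜 s * Z).trace‖ ≤ r ⬝ᵥ s := by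
  -- AM-GM: the products `‖A i j‖ * ‖Z j i‖` lie below a doubly substochastic matrix.
  set B : Matrix (Fin d) (Fin d) ℝ := of fun i j => (‖A i j‖ ^ 2 + ‖Z j i‖ ^ 2) / 2
  have hrow (i) : ∑ j, B i j ≤ 1 := by
    simp only [B, of_apply, ← Finset.sum_div, Finset.sum_add_distrib]
    linarith [sum_norm_sq_row_le_sq_l2_opNorm A i, sum_norm_sq_col_le_sq_l2_opNorm Z i,
      pow_le_one₀ (n := 2) (norm_nonneg _) hA, pow_le_one₀ (n := 2) (norm_nonneg _) hZ]
  have hcol (j) : ∑ i, B i j ≤ 1 := by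
    simp only [B, of_apply, ← Finset.sum_div, Finset.sum_add_distrib]
    linarith [sum_norm_sq_col_le_sq_l2_opNorm A j, sum_norm_sq_row_le_sq_l2_opNorm Z j,
      pow_le_one₀ (n := 2) (norm_nonneg _) hA, pow_le_one₀ (n := 2) (norm_nonneg _) hZ]
  have hAZ (i j) : ‖A i j‖ * ‖Z j i‖ ≤ B i j := by
    have := two_mul_le_add_sq ‖A i j‖ ‖Z j i‖
    simp only [B, of_apply]
    linarith
  calc ‖(realDiagonal 𝕜 r * A * realDiagonal 𝕜 s * Z).trace‖
      ≤ ∑ i, ∑ j, ‖(r i : 𝕜) * A i j * (s j : 𝕜) * Z j i‖ := by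
        rw [trace_realDiagonal_mul_mul]
        exact norm_sum_le_of_le _ fun i _ => norm_sum_le _ _
    _ = ∑ i, ∑ j, r i * s j * (‖A i j‖ * ‖Z j i‖) := by
        refine Finset.sum_congr rfl fun i _ => Finset.sum_congr rfl fun j _ => ?_
        simp only [norm_mul, RCLike.norm_ofReal, abs_of_nonneg (hr₀ i), abs_of_nonneg (hs₀ j)]
        ring
    _ ≤ ∑ i, ∑ j, r i * s j * B i j := by
        gcongr with i _ j _
        · exact mul_nonneg (hr₀ i) (hs₀ j)
        · exact hAZ i j
    _ = r ⬝ᵥ (B *ᵥ s) := by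
        simp only [dotProduct, mulVec, Finset.mul_sum, mul_assoc, mul_comm (s _)]
    _ ≤ r ⬝ᵥ s := dotProduct_mulVec_le_of_substochastic
        (fun i j => by simp only [B, of_apply]; positivity) hrow hcol hr hr₀ hs hs₀

end Contraction

section SingularValues

variable {𝕜 n : Type*} [RCLike 𝕜] [Fintype n] {d : ℕ}

theorem eq_of_conj_realDiagonal_eq {V W : Matrix (Fin d) (Fin d) 𝕜}
    (hV : V ∈ unitaryGroup (Fin d) 𝕜) (hW : W ∈ unitaryGroup (Fin d) 𝕜) {v w : Fin d → ℝ}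
    (hv : Antitone v) (hw : Antitone w)
    (h : V * realDiagonal 𝕜 v * Vᴴ = W * realDiagonal 𝕜 w * Wᴴ) : v = w := by
  have roots_charpoly {U : Matrix (Fin d) (Fin d) 𝕜} (hU : U ∈ unitaryGroup (Fin d) 𝕜)
      (u : Fin d → ℝ) : (U * realDiagonal 𝕜 u * Uᴴ).charpoly.roots =
        Finset.univ.val.map (RCLike.ofReal ∘ u) := by
    have hU' : Uᴴ * U = 1 := mem_unitaryGroup_iff'.1 hU
    rw [charpoly_mul_comm, ← Matrix.mul_assoc, hU', Matrix.one_mul, charpoly_diagonal,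
      Polynomial.roots_prod]
    · simp [Multiset.bind_singleton]
    · exact Finset.prod_ne_zero_iff.2 fun i _ => Polynomial.X_sub_C_ne_zero _
  have hroots := congrArg (fun A : Matrix (Fin d) (Fin d) 𝕜 => A.charpoly.roots) h
  simp only [roots_charpoly hV, roots_charpoly hW, ← Multiset.map_map] at hroots
  have hvw := Multiset.map_injective RCLike.ofReal_injective hroots
  rw [Fin.univ_val_map, Fin.univ_val_map, Multiset.coe_eq_coe] at hvw
  exact List.ofFn_injective (hvw.eq_of_sortedGE hv.sortedGE_ofFn hw.sortedGE_ofFn)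

theorem exists_eq_conj_realDiagonal_eigenvalues₀ {A : Matrix (Fin d) (Fin d) 𝕜}
    (hA : A.IsHermitian) : ∃ V ∈ unitaryGroup (Fin d) 𝕜, A = V *
      realDiagonal 𝕜 (fun i => hA.eigenvalues₀ (i.cast (Fintype.card_fin d).symm)) * Vᴴ := by
  set e : Fin d ≃ Fin d := (finCongr (Fintype.card_fin d).symm).trans
    (Fintype.equivOfCardEq (Fintype.card_fin _))
  have he : (fun i => hA.eigenvalues₀ (i.cast (Fintype.card_fin d).symm)) = hA.eigenvalues ∘ e := by
    ext i
    simp [e, IsHermitian.eigenvalues]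
  set W := (hA.eigenvectorUnitary : Matrix (Fin d) (Fin d) 𝕜)
  have hW : W * Wᴴ = 1 := Unitary.coe_mul_star_self hA.eigenvectorUnitary
  have hspec : A = W * realDiagonal 𝕜 hA.eigenvalues * Wᴴ := by
    conv_lhs => rw [hA.spectral_theorem, Unitary.conjStarAlgAut_apply]
    rfl
  refine ⟨W.submatrix id e, mem_unitaryGroup_iff.2 ?_, ?_⟩
  · rw [star_eq_conjTranspose, conjTranspose_submatrix, submatrix_mul_equiv, hW, submatrix_id_id]
  · have hdiag : realDiagonal 𝕜 (hA.eigenvalues ∘ e) =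
        (realDiagonal 𝕜 hA.eigenvalues).submatrix e e :=
      (submatrix_diagonal_equiv (RCLike.ofReal ∘ hA.eigenvalues) e).symm
    rw [he, hdiag, conjTranspose_submatrix, submatrix_mul_equiv, submatrix_mul_equiv,
      submatrix_id_id, ← hspec]

/-- The singular values of `M` in decreasing order, as many as `M` has rows. They are those of the
linear map of `Mᴴ`, whose domain provides that number. -/
def singularValues (M : Matrix (Fin d) n 𝕜) (i : Fin d) : ℝ :=
  (toEuclideanLin Mᴴ).singularValues i

theorem singularValues_antitone (M : Matrix (Fin d) n 𝕜) : Antitone (singularValues M) :=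
  fun _ _ hij => LinearMap.singularValues_antitone _ hij

theorem singularValues_nonneg (M : Matrix (Fin d) n 𝕜) (i : Fin d) : 0 ≤ singularValues M i :=
  LinearMap.singularValues_nonneg _ _

theorem antitone_singularValues_sq (M : Matrix (Fin d) n 𝕜) : Antitone (singularValues M ^ 2) :=
  fun _ _ hij => pow_le_pow_left₀ (singularValues_nonneg M _) (singularValues_antitone M hij) 2

theorem singularValues_sq_apply (M : Matrix (Fin d) n 𝕜) (i : Fin d) :
    singularValues M i ^ 2 = (isHermitian_mul_conjTranspose_self M).eigenvalues₀
      (i.cast (Fintype.card_fin d).symm) := by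
  have hcongr {T T' : EuclideanSpace 𝕜 (Fin d) →ₗ[𝕜] EuclideanSpace 𝕜 (Fin d)}
      (hT : T.IsSymmetric) (hT' : T'.IsSymmetric) (h : T = T') :
      hT.eigenvalues finrank_euclideanSpace = hT'.eigenvalues finrank_euclideanSpace := by
    subst h
    rfl
  have hT : LinearMap.adjoint (toEuclideanLin Mᴴ) ∘ₗ toEuclideanLin Mᴴ =
      toEuclideanLin (M * Mᴴ) := by
    classical
    rw [← toEuclideanLin_conjTranspose_eq_adjoint, conjTranspose_conjTranspose]
    exact (toLpLin_mul_same 2 M Mᴴ).symm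
  exact ((toEuclideanLin Mᴴ).sq_singularValues_fin finrank_euclideanSpace
    (i.cast (Fintype.card_fin d).symm)).trans (congrFun (hcongr _ _ hT) _)

theorem exists_mul_conjTranspose_self_eq (M : Matrix (Fin d) n 𝕜) :
    ∃ V ∈ unitaryGroup (Fin d) 𝕜, M * Mᴴ = V * realDiagonal 𝕜 (singularValues M ^ 2) * Vᴴ := by
  have h := exists_eq_conj_realDiagonal_eigenvalues₀ (isHermitian_mul_conjTranspose_self M)
  simp only [← singularValues_sq_apply] at h
  exact h

theorem singularValues_eq {M : Matrix (Fin d) n 𝕜} {V : Matrix (Fin d) (Fin d) 𝕜}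
    (hV : V ∈ unitaryGroup (Fin d) 𝕜) {s : Fin d → ℝ} (hs : Antitone s) (hs₀ : ∀ i, 0 ≤ s i)
    (h : M * Mᴴ = V * realDiagonal 𝕜 (s ^ 2) * Vᴴ) : singularValues M = s := by
  obtain ⟨W, hW, hM⟩ := exists_mul_conjTranspose_self_eq M
  have hsq : singularValues M ^ 2 = s ^ 2 :=
    eq_of_conj_realDiagonal_eq hW hV (antitone_singularValues_sq M)
      (fun _ _ hij => pow_le_pow_left₀ (hs₀ _) (hs hij) 2) (hM.symm.trans h)
  ext i
  exact (pow_left_inj₀ (singularValues_nonneg M i) (hs₀ i) two_ne_zero).1 (congrFun hsq i)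

theorem singularValues_congr {l : Type*} [Fintype l] {M : Matrix (Fin d) n 𝕜}
    {N : Matrix (Fin d) l 𝕜} (h : M * Mᴴ = N * Nᴴ) : singularValues M = singularValues N := by
  obtain ⟨V, hV, hN⟩ := exists_mul_conjTranspose_self_eq N
  exact singularValues_eq hV (singularValues_antitone N) (singularValues_nonneg N) (h.trans hN)

theorem singularValues_eq_zero_of_rank_le {M : Matrix (Fin d) n 𝕜} {i : Fin d} (h : M.rank ≤ i) :
    singularValues M i = 0 := by
  refine (LinearMap.singularValues_eq_zero_iff_le_finrank_range _).2 ?_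
  rwa [← rank_conjTranspose, rank_eq_finrank_range_toLin _ (PiLp.basisFun 2 𝕜 _)
    (PiLp.basisFun 2 𝕜 _)] at h

end SingularValues

section SingularValueDecomposition

variable {𝕜 m n : Type*} [RCLike 𝕜] [Fintype m] [Fintype n]

theorem exists_eq_realDiagonal_mul [DecidableEq m] {R : Matrix m n 𝕜} {s : m → ℝ}
    (h : R * Rᴴ = realDiagonal 𝕜 (s ^ 2)) :
    ∃ X : Matrix m n 𝕜, R = realDiagonal 𝕜 s * X ∧
      X * Xᴴ = realDiagonal 𝕜 fun i => if s i = 0 then 0 else 1 := by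
  have hscale (v : m → ℝ) : (realDiagonal 𝕜 v * R) * (realDiagonal 𝕜 v * R)ᴴ =
      realDiagonal 𝕜 (v * s ^ 2 * v) := by
    rw [conjTranspose_mul, conjTranspose_realDiagonal, ← realDiagonal_mul_realDiagonal,
      ← realDiagonal_mul_realDiagonal, ← h]
    simp only [Matrix.mul_assoc]
  have hzero : realDiagonal 𝕜 (1 - s * s⁻¹) * R = 0 := by
    refine self_mul_conjTranspose_eq_zero.1 ((hscale _).trans ?_)
    have : (1 - s * s⁻¹) * s ^ 2 * (1 - s * s⁻¹) = 0 := by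
      ext i
      rcases eq_or_ne (s i) 0 with hi | hi <;> simp [hi]
    simp [this]
  have hdiag : realDiagonal 𝕜 (1 - s * s⁻¹) = 1 - realDiagonal 𝕜 s * realDiagonal 𝕜 s⁻¹ := by
    rw [realDiagonal_mul_realDiagonal, ← diagonal_one, diagonal_sub]
    simp
  refine ⟨realDiagonal 𝕜 s⁻¹ * R, ?_, (hscale _).trans (congrArg _ (funext fun i => ?_))⟩
  · rwa [hdiag, Matrix.sub_mul, Matrix.one_mul, sub_eq_zero, Matrix.mul_assoc] at hzero
  · rcases eq_or_ne (s i) 0 with hi | hi <;> simp [hi, sq]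

theorem exists_singularValueDecomposition [DecidableEq m] {M : Matrix m n 𝕜} {V : Matrix m m 𝕜}
    (hV : V ∈ unitaryGroup m 𝕜) {s : m → ℝ} (h : M * Mᴴ = V * realDiagonal 𝕜 (s ^ 2) * Vᴴ) :
    ∃ X : Matrix m n 𝕜, M = V * realDiagonal 𝕜 s * X ∧
      X * Xᴴ = realDiagonal 𝕜 fun i => if s i = 0 then 0 else 1 := by
  have hVV : Vᴴ * V = 1 := mem_unitaryGroup_iff'.1 hV
  have hVV' : V * Vᴴ = 1 := mem_unitaryGroup_iff.1 hV
  have hrotate : Vᴴ * M * (Vᴴ * M)ᴴ = realDiagonal 𝕜 (s ^ 2) := by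
    calc Vᴴ * M * (Vᴴ * M)ᴴ = Vᴴ * (M * Mᴴ) * V := by
          simp only [conjTranspose_mul, conjTranspose_conjTranspose, Matrix.mul_assoc]
      _ = Vᴴ * V * realDiagonal 𝕜 (s ^ 2) * (Vᴴ * V) := by
          rw [h]
          simp only [Matrix.mul_assoc]
      _ = realDiagonal 𝕜 (s ^ 2) := by rw [hVV, Matrix.one_mul, Matrix.mul_one]
  obtain ⟨X, hX, hXX⟩ := exists_eq_realDiagonal_mul hrotate
  refine ⟨X, ?_, hXX⟩
  rw [Matrix.mul_assoc, ← hX, ← Matrix.mul_assoc, hVV', Matrix.one_mul]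

/-- The squared Hilbert–Schmidt norm. -/
def hsNormSq (M : Matrix m n 𝕜) : ℝ :=
  ∑ i, ∑ j, ‖M i j‖ ^ 2

theorem trace_mul_conjTranspose_self (M : Matrix m n 𝕜) :
    (M * Mᴴ).trace = (hsNormSq M : 𝕜) := by
  simp [hsNormSq, trace, mul_apply, RCLike.mul_conj]

theorem hsNormSq_sub (M N : Matrix m n 𝕜) :
    hsNormSq (M - N) = hsNormSq M + hsNormSq N - 2 * RCLike.re (Nᴴ * M).trace := by
  have htrace : RCLike.re (Nᴴ * M).trace = ∑ i, ∑ j, RCLike.re (inner 𝕜 (M i j) (N i j)) := by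
    simp only [trace, diag_apply, mul_apply, conjTranspose_apply, map_sum]
    rw [Finset.sum_comm]
    refine Finset.sum_congr rfl fun i _ => Finset.sum_congr rfl fun j _ => ?_
    rw [inner_re_symm, RCLike.inner_apply, mul_comm, RCLike.star_def]
  simp only [hsNormSq, Matrix.sub_apply, norm_sub_sq (𝕜 := 𝕜), htrace, Finset.sum_add_distrib,
    Finset.sum_sub_distrib, ← Finset.mul_sum]
  ring

variable {d : ℕ}

theorem hsNormSq_eq_sum_singularValues_sq (M : Matrix (Fin d) n 𝕜) :
    hsNormSq M = ∑ i, singularValues M i ^ 2 := by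
  obtain ⟨V, hV, h⟩ := exists_mul_conjTranspose_self_eq M
  have hVV : Vᴴ * V = 1 := mem_unitaryGroup_iff'.1 hV
  refine RCLike.ofReal_injective (K := 𝕜) ?_
  rw [← trace_mul_conjTranspose_self, h, trace_mul_comm, ← Matrix.mul_assoc, hVV, Matrix.one_mul,
    trace_realDiagonal]
  rfl

section

open scoped Matrix.Norms.L2Operator

theorem norm_trace_conjTranspose_mul_le (M N : Matrix (Fin d) n 𝕜) :
    ‖(Nᴴ * M).trace‖ ≤ singularValues N ⬝ᵥ singularValues M := by
  classical
  obtain ⟨V, hV, hM⟩ := exists_mul_conjTranspose_self_eq M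
  obtain ⟨W, hW, hN⟩ := exists_mul_conjTranspose_self_eq N
  obtain ⟨X, hMX, hX⟩ := exists_singularValueDecomposition hV hM
  obtain ⟨Y, hNY, hY⟩ := exists_singularValueDecomposition hW hN
  have hcontraction {Z : Matrix (Fin d) n 𝕜} {s : Fin d → ℝ}
      (hZ : Z * Zᴴ = realDiagonal 𝕜 fun i => if s i = 0 then 0 else 1) : ‖Z‖ ≤ 1 :=
    l2_opNorm_le_one_of_mul_conjTranspose_eq (fun i => by split_ifs <;> simp) hZ
  have htrace : (Nᴴ * M).trace = (realDiagonal 𝕜 (singularValues N) * (Wᴴ * V) *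
      realDiagonal 𝕜 (singularValues M) * (X * Yᴴ)).trace := by
    rw [← Matrix.mul_assoc _ X, trace_mul_comm _ Yᴴ]
    conv_lhs => rw [hMX, hNY]
    simp only [conjTranspose_mul, conjTranspose_realDiagonal, Matrix.mul_assoc]
  rw [htrace]
  refine norm_trace_realDiagonal_mul_mul_le ?_ ?_ (singularValues_antitone N)
    (singularValues_nonneg N) (singularValues_antitone M) (singularValues_nonneg M)
  · refine l2_opNorm_mul_le_one ?_ (l2_opNorm_le_one_of_mem_unitaryGroup hV)
    exact l2_opNorm_le_one_of_mem_unitaryGroup (Unitary.star_mem hW)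
  · refine l2_opNorm_mul_le_one (hcontraction hX) ?_
    rw [l2_opNorm_conjTranspose]
    exact hcontraction hY

end

theorem sum_singularValues_sq_le_hsNormSq_sub {M N : Matrix (Fin d) n 𝕜} {k : ℕ}
    (hN : N.rank ≤ k) :
    ∑ i with k ≤ i.val, singularValues M i ^ 2 ≤ hsNormSq (M - N) := by
  have hle : ∑ i with k ≤ i.val, singularValues M i ^ 2 ≤
      ∑ i, (singularValues M i - singularValues N i) ^ 2 := by
    rw [Finset.sum_filter]
    refine Finset.sum_le_sum fun i _ => ?_
    split_ifs with hi
    · rw [singularValues_eq_zero_of_rank_le (hN.trans hi), sub_zero]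
    · positivity
  have htrace := (RCLike.re_le_norm _).trans (norm_trace_conjTranspose_mul_le M N)
  simp only [sub_sq, Finset.sum_add_distrib, Finset.sum_sub_distrib, mul_assoc,
    ← Finset.mul_sum, ← hsNormSq_eq_sum_singularValues_sq] at hle
  rw [dotProduct_comm, dotProduct] at htrace
  rw [hsNormSq_sub]
  linarith

theorem exists_rank_le_hsNormSq_sub_eq (M : Matrix (Fin d) n 𝕜) (k : ℕ) :
    ∃ N : Matrix (Fin d) n 𝕜, N.rank ≤ k ∧
      hsNormSq (M - N) = ∑ i with k ≤ i.val, singularValues M i ^ 2 := by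
  obtain ⟨V, hV, hM⟩ := exists_mul_conjTranspose_self_eq M
  have hVV : Vᴴ * V = 1 := mem_unitaryGroup_iff'.1 hV
  have hVV' : V * Vᴴ = 1 := mem_unitaryGroup_iff.1 hV
  set e : Fin d → ℝ := fun i => if i.val < k then 1 else 0
  refine ⟨V * realDiagonal 𝕜 e * Vᴴ * M, ?_, ?_⟩
  · calc (V * realDiagonal 𝕜 e * Vᴴ * M).rank
        ≤ (realDiagonal 𝕜 e).rank := (rank_mul_le_left _ _).trans
          ((rank_mul_le_left _ _).trans (rank_mul_le_right _ _))
      _ ≤ k := by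
        rw [rank_diagonal, Fintype.card_subtype]
        simp [e, Fin.card_filter_val_lt]
  · have hsub : M - V * realDiagonal 𝕜 e * Vᴴ * M = V * realDiagonal 𝕜 (1 - e) * Vᴴ * M := by
      have hdiag : realDiagonal 𝕜 (1 - e) = 1 - realDiagonal 𝕜 e := by
        rw [← diagonal_one, diagonal_sub]
        simp
      simp only [hdiag, Matrix.mul_sub, Matrix.sub_mul, Matrix.mul_one, hVV', Matrix.one_mul]
    refine RCLike.ofReal_injective (K := 𝕜) ?_
    calc (hsNormSq (M - V * realDiagonal 𝕜 e * Vᴴ * M) : 𝕜)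
        = (V * realDiagonal 𝕜 (1 - e) * Vᴴ * (M * Mᴴ) * V * realDiagonal 𝕜 (1 - e) * Vᴴ).trace := by
          rw [hsub, ← trace_mul_conjTranspose_self]
          simp only [conjTranspose_mul, conjTranspose_realDiagonal, conjTranspose_conjTranspose,
            Matrix.mul_assoc]
      _ = (realDiagonal 𝕜 (1 - e) * (Vᴴ * V) * realDiagonal 𝕜 (singularValues M ^ 2) * (Vᴴ * V) *
            realDiagonal 𝕜 (1 - e) * (Vᴴ * V)).trace := by
          rw [hM, ← Matrix.mul_assoc _ Vᴴ V, trace_mul_comm _ V]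
          simp only [Matrix.mul_assoc]
      _ = ((∑ i with k ≤ i.val, singularValues M i ^ 2 : ℝ) : 𝕜) := by
          simp only [hVV, Matrix.mul_one, realDiagonal_mul_realDiagonal, trace_realDiagonal,
            Finset.sum_filter]
          congr 2 with i
          by_cases hi : i.val < k <;> simp [e, hi, not_le.2, not_lt.1]

end SingularValueDecomposition

section ProductKrausOperators

variable {𝕜 m n m' n' : Type*} [RCLike 𝕜] [Fintype m] [Fintype n]

theorem kronecker_mulVec_vec_transpose (A : Matrix m' m 𝕜) (B : Matrix n' n 𝕜)
    (M : Matrix m n 𝕜) : (A ⊗ₖ B) *ᵥ vec Mᵀ = vec (A * M * Bᵀ)ᵀ := by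
  rw [kronecker_mulVec_vec, transpose_mul, transpose_mul, transpose_transpose, Matrix.mul_assoc]

theorem star_vec_transpose_dotProduct_vec_transpose (M N : Matrix m n 𝕜) :
    star (vec Nᵀ) ⬝ᵥ vec Mᵀ = (Nᴴ * M).trace := by
  rw [star_vec_dotProduct_vec, ← trace_transpose, transpose_mul, transpose_transpose,
    trace_mul_comm]
  rfl

theorem hsNormSq_eq_star_vec_dotProduct_vec (M : Matrix m n 𝕜) :
    (hsNormSq M : 𝕜) = star (vec Mᵀ) ⬝ᵥ vec Mᵀ := by
  rw [star_vec_transpose_dotProduct_vec_transpose, ← trace_mul_conjTranspose_self, trace_mul_comm]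

theorem sum_hsNormSq_mul_mul_transpose [DecidableEq m] [DecidableEq n] [Fintype m'] [Fintype n']
    {ι : Type*} [Fintype ι] {A : ι → Matrix m' m 𝕜} {B : ι → Matrix n' n 𝕜}
    (h : ∑ k, (A k ⊗ₖ B k)ᴴ * (A k ⊗ₖ B k) = 1) (M : Matrix m n 𝕜) :
    ∑ k, hsNormSq (A k * M * (B k)ᵀ) = hsNormSq M := by
  have hterm (k) : (hsNormSq (A k * M * (B k)ᵀ) : 𝕜) =
      star (vec Mᵀ) ⬝ᵥ (((A k ⊗ₖ B k)ᴴ * (A k ⊗ₖ B k)) *ᵥ vec Mᵀ) := by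
    rw [hsNormSq_eq_star_vec_dotProduct_vec, ← kronecker_mulVec_vec_transpose, star_mulVec,
      ← dotProduct_mulVec, mulVec_mulVec]
  refine RCLike.ofReal_injective (K := 𝕜) ?_
  rw [RCLike.ofReal_sum, Finset.sum_congr rfl fun k _ => hterm k, ← dotProduct_sum,
    ← Matrix.sum_mulVec, h, one_mulVec,
    hsNormSq_eq_star_vec_dotProduct_vec]

end ProductKrausOperators

section BipartiteVectors

variable {a b a' b' : ℕ}

/-- The coefficient matrix of a bipartite vector. Its singular values are the Schmidt
coefficients. -/
def coeffMatrix (Φ : BipVec a b) : Matrix (Fin a) (Fin b) ℂ :=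
  of fun i j => Φ (i, j)

theorem reducedDensity_eq (Φ : BipVec a b) :
    reducedDensity Φ = coeffMatrix Φ * (coeffMatrix Φ)ᴴ := by
  ext i i'
  simp [reducedDensity, partialTraceB, pureState, vecMulVec_apply, coeffMatrix, mul_apply]

theorem hsNormSq_coeffMatrix (Φ : BipVec a b) : hsNormSq (coeffMatrix Φ) = ‖Φ‖ ^ 2 := by
  rw [EuclideanSpace.norm_sq_eq, Fintype.sum_prod_type]
  rfl

theorem fidelity_sum {ι : Type*} (s : Finset ι) (Ψ : BipVec a b) (X : ι → BipOp a b) :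
    fidelity Ψ (∑ k ∈ s, X k) = ∑ k ∈ s, fidelity Ψ (X k) := by
  simp only [fidelity, Matrix.sum_mulVec, dotProduct_sum, Complex.re_sum]

theorem fidelity_mul_pureState_mul (Φ : BipVec a b) (Ψ : BipVec a' b')
    (S : Matrix (Fin a' × Fin b') (Fin a × Fin b) ℂ) :
    fidelity Ψ (S * pureState Φ * Sᴴ) =
      ‖(fun x => star (Ψ x)) ⬝ᵥ (S *ᵥ fun x => Φ x)‖ ^ 2 := by
  set z := (fun x => star (Ψ x)) ⬝ᵥ (S *ᵥ fun x => Φ x) with hz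
  have hpure : S * pureState Φ * Sᴴ =
      vecMulVec (S *ᵥ fun x => Φ x) (star (S *ᵥ fun x => Φ x)) := by
    rw [pureState, mul_vecMulVec, vecMulVec_mul, star_mulVec]
    rfl
  have hstar : star (S *ᵥ fun x => Φ x) ⬝ᵥ (fun x => Ψ x) = star z := by
    rw [hz, star_dotProduct]
    rfl
  rw [fidelity, hpure, vecMulVec_mulVec, hstar, dotProduct_smul, ← hz, op_smul_eq_mul,
    RCLike.star_def, Complex.mul_conj']
  exact_mod_cast rfl

theorem fidelity_kronecker (Φ : BipVec a b) (Ψ : BipVec a' b') (A : Matrix (Fin a') (Fin a) ℂ)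
    (B : Matrix (Fin b') (Fin b) ℂ) :
    fidelity Ψ ((A ⊗ₖ B) * pureState Φ * (A ⊗ₖ B)ᴴ) =
      ‖((coeffMatrix Ψ)ᴴ * (A * coeffMatrix Φ * Bᵀ)).trace‖ ^ 2 := by
  rw [fidelity_mul_pureState_mul, ← star_vec_transpose_dotProduct_vec_transpose,
    ← kronecker_mulVec_vec_transpose]
  rfl

end BipartiteVectors

section SeparableOperations

variable {a b a' b' : ℕ}

/-- Separable operations: those with a finite trace-preserving family of product Kraus
operators. -/
def IsSeparable (C : BipOp a b → BipOp a' b') : Prop :=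
  ∃ (ι : Type) (_ : Fintype ι) (A : ι → Matrix (Fin a') (Fin a) ℂ)
    (B : ι → Matrix (Fin b') (Fin b) ℂ),
    (∀ X, C X = ∑ k, (A k ⊗ₖ B k) * X * (A k ⊗ₖ B k)ᴴ) ∧
      ∑ k, (A k ⊗ₖ B k)ᴴ * (A k ⊗ₖ B k) = 1

theorem isSeparable_id : IsSeparable fun X : BipOp a b => X :=
  ⟨Unit, inferInstance, fun _ => 1, fun _ => 1, by simp, by simp⟩

theorem IsSeparable.comp_instrument {κ : Type} [Fintype κ] {l : ℕ} {e f : κ → ℕ}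
    {P : (k : κ) → Fin l → Matrix (Fin (e k)) (Fin a) ℂ}
    {Q : (k : κ) → Fin l → Matrix (Fin (f k)) (Fin b) ℂ}
    (hPQ : ∑ k, ∑ r, (P k r ⊗ₖ Q k r)ᴴ * (P k r ⊗ₖ Q k r) = 1)
    {C : (k : κ) → BipOp (e k) (f k) → BipOp a' b'} (hC : ∀ k, IsSeparable (C k)) :
    IsSeparable fun X : BipOp a b =>
      ∑ k, C k (∑ r, (P k r ⊗ₖ Q k r) * X * (P k r ⊗ₖ Q k r)ᴴ) := by
  choose ι hι A B hX hAB using hC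
  refine ⟨(k : κ) × (Fin l × ι k), inferInstance, fun x => A x.1 x.2.2 * P x.1 x.2.1,
    fun x => B x.1 x.2.2 * Q x.1 x.2.1, fun X => ?_, ?_⟩
  all_goals simp only [Fintype.sum_sigma, Fintype.sum_prod_type, mul_kronecker_mul,
    conjTranspose_mul]
  · refine Finset.sum_congr rfl fun k _ => ?_
    rw [hX, Finset.sum_comm]
    simp only [Matrix.mul_sum, Matrix.sum_mul, Matrix.mul_assoc]
  · have hregroup (k r s) : (P k r ⊗ₖ Q k r)ᴴ * (A k s ⊗ₖ B k s)ᴴ *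
        ((A k s ⊗ₖ B k s) * (P k r ⊗ₖ Q k r)) =
        (P k r ⊗ₖ Q k r)ᴴ * ((A k s ⊗ₖ B k s)ᴴ * (A k s ⊗ₖ B k s)) * (P k r ⊗ₖ Q k r) := by
      simp only [Matrix.mul_assoc]
    simp only [hregroup, ← Matrix.mul_sum, ← Matrix.sum_mul, hAB, Matrix.mul_one, hPQ]

theorem IsLOCC.isSeparable {C : BipOp a b → BipOp a' b'} (h : IsLOCC C) : IsSeparable C := by
  induction h with
  | refl => exact isSeparable_id
  | @alice a b m l e K hK C _ ih =>
    refine IsSeparable.comp_instrument (P := K) (Q := fun _ _ => 1) ?_ ih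
    simp only [conjTranspose_kronecker, ← mul_kronecker_mul, conjTranspose_one, Matrix.mul_one]
    rw [← one_kronecker_one, ← hK]
    ext x y
    simp [Matrix.sum_apply, Finset.sum_mul]
  | @bob a b m l e K hK C _ ih =>
    refine IsSeparable.comp_instrument (P := fun _ _ => 1) (Q := K) ?_ ih
    simp only [conjTranspose_kronecker, ← mul_kronecker_mul, conjTranspose_one, Matrix.mul_one]
    rw [← one_kronecker_one, ← hK]
    ext x y
    simp [Matrix.sum_apply, Finset.mul_sum]

end SeparableOperations

section UpperBound

/-- The decreasing nonnegative vectors with the same sum as `v` whose partial sums dominate those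
of `v`. -/
def majorizingVectors {d : ℕ} (v : Fin d → ℝ) : Set (Fin d → ℝ) :=
  {p | Antitone p ∧ (∀ i, 0 ≤ p i) ∧ ∑ i, p i = ∑ i, v i ∧ PartialSumsLE v p}

theorem sum_singularValues_sq_mem_majorizingVectors {𝕜 n n' ι : Type*} {d : ℕ} [RCLike 𝕜]
    [Fintype n] [DecidableEq n] [Fintype n'] [Fintype ι]
    {A : ι → Matrix (Fin d) (Fin d) 𝕜} {B : ι → Matrix n' n 𝕜}
    (h : ∑ k, (A k ⊗ₖ B k)ᴴ * (A k ⊗ₖ B k) = 1) (M : Matrix (Fin d) n 𝕜) :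
    ∑ k, singularValues (A k * M * (B k)ᵀ) ^ 2 ∈ majorizingVectors (singularValues M ^ 2) := by
  have hsum : ∑ k, ∑ i, singularValues (A k * M * (B k)ᵀ) i ^ 2 = ∑ i, singularValues M i ^ 2 := by
    simp only [← hsNormSq_eq_sum_singularValues_sq, sum_hsNormSq_mul_mul_transpose h]
  refine ⟨?_, fun i => ?_, ?_, fun m => ?_⟩
  · simp only [Antitone, Finset.sum_apply]
    exact fun i j hij => Finset.sum_le_sum fun k _ => antitone_singularValues_sq _ hij
  · rw [Finset.sum_apply]
    exact Finset.sum_nonneg fun k _ => sq_nonneg _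
  · simp only [Finset.sum_apply]
    rwa [Finset.sum_comm]
  -- The local operators keep the rank of the best approximant `N` of `M` at most `m`.
  · obtain ⟨N, hNrank, hN⟩ := exists_rank_le_hsNormSq_sub_eq M m
    have htail : ∑ k, ∑ i with m ≤ i.val, singularValues (A k * M * (B k)ᵀ) i ^ 2 ≤
        ∑ i with m ≤ i.val, singularValues M i ^ 2 := by
      rw [← hN, ← sum_hsNormSq_mul_mul_transpose h]
      refine Finset.sum_le_sum fun k _ => ?_
      rw [Matrix.mul_sub, Matrix.sub_mul]
      exact sum_singularValues_sq_le_hsNormSq_sub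
        ((rank_mul_le_left _ _).trans ((rank_mul_le_right _ _).trans hNrank))
    have hsplit (f : Fin d → ℝ) :
        ∑ i, f i = ∑ i with i.val < m, f i + ∑ i with m ≤ i.val, f i := by
      simpa only [not_lt] using (Finset.sum_filter_add_sum_filter_not _ (fun i => i.val < m) f).symm
    simp only [Finset.sum_apply, Pi.pow_apply]
    rw [Finset.sum_comm]
    simp only [hsplit, Finset.sum_add_distrib] at hsum
    linarith

theorem IsSeparable.exists_fidelity_le {a b b' : ℕ} {C : BipOp a b → BipOp a b'}
    (hC : IsSeparable C) (Φ : BipVec a b) (Ψ : BipVec a b') :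
    ∃ p ∈ majorizingVectors (singularValues (coeffMatrix Φ) ^ 2),
      fidelity Ψ (C (pureState Φ)) ≤ (∑ i, √(p i) * singularValues (coeffMatrix Ψ) i) ^ 2 := by
  obtain ⟨ι, _, A, B, hX, hAB⟩ := hC
  refine ⟨_, sum_singularValues_sq_mem_majorizingVectors hAB _, ?_⟩
  rw [hX, fidelity_sum]
  simp only [Finset.sum_apply]
  refine le_trans (Finset.sum_le_sum fun k _ => ?_)
    (sum_sq_sum_sqrt_mul_le (singularValues_nonneg _) fun k i => sq_nonneg _)
  rw [fidelity_kronecker]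
  refine pow_le_pow_left₀ (norm_nonneg _)
    ((norm_trace_conjTranspose_mul_le _ _).trans_eq (Finset.sum_congr rfl fun i _ => ?_)) 2
  rw [Pi.pow_apply, Real.sqrt_sq (singularValues_nonneg _ i), mul_comm]

end UpperBound

section Achievability

theorem mul_ite_eq_zero_zero_one {n R : Type*} [MulZeroOneClass R] [DecidableEq R] (s : n → R) :
    (s * fun i => if s i = 0 then 0 else 1) = s := by
  ext i
  by_cases hi : s i = 0 <;> simp [hi]

open scoped Matrix.Norms.L2Operator

theorem exists_kraus_completion_transpose {n : Type*} [Fintype n] [DecidableEq n] [Nonempty n]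
    {k : ℕ} {Y : Matrix (Fin k) n ℂ} (hY : ‖Y‖ ≤ 1) :
    ∃ L : Fin (k + 1) → Matrix n (Fin k) ℂ, L 0 = Yᵀ ∧ ∑ r, (L r)ᴴ * L r = 1 := by
  obtain ⟨K, hK₀, hK⟩ := exists_kraus_completion ((l2_opNorm_conjTranspose Y).trans_le hY)
  refine ⟨fun r => (K r)ᴴᵀ, by simp only [hK₀, conjTranspose_conjTranspose], ?_⟩
  have hconj (r) : ((K r)ᴴᵀ)ᴴ * (K r)ᴴᵀ = ((K r)ᴴ * K r)ᵀ := by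
    rw [transpose_mul]
    congr 1
    ext
    simp
  rw [Finset.sum_congr rfl fun r _ => hconj r, ← transpose_sum, hK, transpose_one]

/-- Alice measures with Kraus operators `K j`, and Bob answers the outcome `j` with an instrument
one of whose Kraus operators is `(Y j)ᵀ`. -/
theorem exists_isLOCC_sum_norm_trace_sq_le_fidelity {ι : Type*} [Fintype ι] {a a' b b' : ℕ}
    [NeZero b'] {K : ι → Matrix (Fin a') (Fin a) ℂ} (hK : ∑ j, (K j)ᴴ * K j = 1)
    {Y : ι → Matrix (Fin b) (Fin b') ℂ} (hY : ∀ j, ‖Y j‖ ≤ 1) :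
    ∃ C : BipOp a b → BipOp a' b', IsLOCC C ∧ ∀ Φ Ψ,
      ∑ j, ‖((coeffMatrix Ψ)ᴴ * (K j * coeffMatrix Φ * Y j)).trace‖ ^ 2 ≤
        fidelity Ψ (C (pureState Φ)) := by
  choose L hL₀ hL using fun j => exists_kraus_completion_transpose (hY j)
  set e := (Fintype.equivFin ι).symm
  refine ⟨_, .alice (l := 1) (fun _ => a') (fun j _ => K (e j)) ?_ _ fun j =>
    .bob (m := 1) (fun _ => b') (fun _ => L (e j)) (by simpa using hL (e j)) _ fun _ => .refl,
    fun Φ Ψ => ?_⟩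
  · simpa using (e.sum_comp fun j => (K j)ᴴ * K j).trans hK
  rw [← e.sum_comp, fidelity_sum]
  refine Finset.sum_le_sum fun j _ => ?_
  have hcomp (r) : ((1 : Matrix (Fin a') (Fin a') ℂ) ⊗ₖ L (e j) r) *
      ((K (e j) ⊗ₖ (1 : Matrix (Fin b) (Fin b) ℂ)) * pureState Φ *
        (K (e j) ⊗ₖ (1 : Matrix (Fin b) (Fin b) ℂ))ᴴ) *
      ((1 : Matrix (Fin a') (Fin a') ℂ) ⊗ₖ L (e j) r)ᴴ =
      (K (e j) ⊗ₖ L (e j) r) * pureState Φ * (K (e j) ⊗ₖ L (e j) r)ᴴ := by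
    have : K (e j) ⊗ₖ L (e j) r = ((1 : Matrix (Fin a') (Fin a') ℂ) ⊗ₖ L (e j) r) *
        (K (e j) ⊗ₖ (1 : Matrix (Fin b) (Fin b) ℂ)) := by
      rw [← mul_kronecker_mul, Matrix.mul_one, Matrix.one_mul]
    rw [this, conjTranspose_mul]
    simp only [Matrix.mul_assoc]
  simp only [Finset.univ_unique, Finset.sum_singleton, bobMap, aliceMap, hcomp, fidelity_sum,
    fidelity_kronecker]
  refine le_trans (le_of_eq ?_)
    (Finset.single_le_sum (fun r _ => sq_nonneg _) (Finset.mem_univ (0 : Fin (b + 1))))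
  rw [hL₀, transpose_transpose]

theorem exists_unitary_conj_realDiagonal_comp (𝕜 : Type*) [RCLike 𝕜] {n : Type*} [Fintype n]
    [DecidableEq n] (π : Equiv.Perm n) :
    ∃ Q ∈ unitaryGroup n 𝕜, ∀ p : n → ℝ,
      Q * realDiagonal 𝕜 (p ∘ π) * Qᴴ = realDiagonal 𝕜 p := by
  refine ⟨(1 : Matrix n n 𝕜).submatrix id π, ?_, fun p => ?_⟩
  · rw [mem_unitaryGroup_iff, star_eq_conjTranspose, conjTranspose_submatrix,
      submatrix_mul_equiv]
    simp
  · have : realDiagonal 𝕜 (p ∘ π) = (realDiagonal 𝕜 p).submatrix π π := by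
      rw [submatrix_diagonal_equiv]
      rfl
    rw [this, conjTranspose_submatrix, submatrix_mul_equiv, submatrix_mul_equiv]
    simp

theorem exists_sum_sq_eq_one_mul_eq {ι : Type*} [Fintype ι] [Nonempty ι] {s : ℝ} {f : ι → ℝ}
    (h : s ^ 2 = ∑ j, f j ^ 2) : ∃ c : ι → ℝ, ∑ j, c j ^ 2 = 1 ∧ ∀ j, c j * s = f j := by
  classical
  rcases eq_or_ne s 0 with rfl | hs
  · have hf : ∀ j, f j = 0 := by
      have := (Finset.sum_eq_zero_iff_of_nonneg fun j _ => sq_nonneg (f j)).1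
        (h.symm.trans (zero_pow two_ne_zero))
      simpa using this
    obtain ⟨j₀⟩ := ‹Nonempty ι›
    exact ⟨Pi.single j₀ 1, by simp [Pi.single_apply], by simp [hf]⟩
  · refine ⟨fun j => f j / s, ?_, fun j => div_mul_cancel₀ _ hs⟩
    simp only [div_pow, ← Finset.sum_div, ← h]
    exact div_self (pow_ne_zero 2 hs)

theorem sum_conjTranspose_mul_realDiagonal_mul_eq_one {𝕜 n ι : Type*} [RCLike 𝕜] [Fintype n]
    [DecidableEq n] [Fintype ι] {G : ι → Matrix n n 𝕜} (hG : ∀ j, G j ∈ unitaryGroup n 𝕜)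
    {V : Matrix n n 𝕜} (hV : V ∈ unitaryGroup n 𝕜) {c : ι → n → ℝ}
    (hc : ∀ i, ∑ j, c j i ^ 2 = 1) :
    ∑ j, (G j * realDiagonal 𝕜 (c j) * Vᴴ)ᴴ * (G j * realDiagonal 𝕜 (c j) * Vᴴ) = 1 := by
  have hGG (j) : (G j)ᴴ * G j = 1 := mem_unitaryGroup_iff'.1 (hG j)
  have hVV : V * Vᴴ = 1 := mem_unitaryGroup_iff.1 hV
  have hterm (j) : (G j * realDiagonal 𝕜 (c j) * Vᴴ)ᴴ * (G j * realDiagonal 𝕜 (c j) * Vᴴ) =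
      V * realDiagonal 𝕜 (c j ^ 2) * Vᴴ := by
    calc _ = V * (realDiagonal 𝕜 (c j) * ((G j)ᴴ * G j) * realDiagonal 𝕜 (c j)) * Vᴴ := by
          simp only [conjTranspose_mul, conjTranspose_realDiagonal, conjTranspose_conjTranspose,
            Matrix.mul_assoc]
      _ = _ := by rw [hGG, Matrix.mul_one, realDiagonal_mul_realDiagonal, sq]
  have hsum : ∑ j, realDiagonal 𝕜 (c j ^ 2) = 1 := by
    ext i i'
    rcases eq_or_ne i i' with rfl | hi
    · simpa [Matrix.sum_apply] using congrArg ((↑) : ℝ → 𝕜) (hc i)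
    · simp [Matrix.sum_apply, hi]
  simp only [hterm, ← Matrix.sum_mul, ← Matrix.mul_sum, hsum, Matrix.mul_one, hVV]

/-- Nielsen's theorem: the measurement `K` of Alice, answered by Bob with the contraction `Y j`,
turns `M` into `W * realDiagonal ℂ u * Z`, up to the square root of the outcome probability
`t j`. -/
theorem exists_measurement_mul_mul_eq {d : ℕ} {n n' : Type*} [Fintype n] [Fintype n']
    [DecidableEq n'] {M : Matrix (Fin d) n ℂ} {u : Fin d → ℝ}
    (h : singularValues M ^ 2 ∈
      convexHull ℝ (Set.range fun π : Equiv.Perm (Fin d) => (u ^ 2) ∘ π))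
    {W : Matrix (Fin d) (Fin d) ℂ} (hW : W ∈ unitaryGroup (Fin d) ℂ) {Z : Matrix (Fin d) n' ℂ}
    (hZ : ‖Z‖ ≤ 1) :
    ∃ (ι : Type) (_ : Fintype ι) (t : ι → ℝ) (K : ι → Matrix (Fin d) (Fin d) ℂ)
      (Y : ι → Matrix n n' ℂ), (∀ j, 0 ≤ t j) ∧ ∑ j, t j = 1 ∧ ∑ j, (K j)ᴴ * K j = 1 ∧
        (∀ j, ‖Y j‖ ≤ 1) ∧ ∀ j, K j * M * Y j = W * realDiagonal ℂ (√(t j) • u) * Z := by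
  classical
  obtain ⟨ι, _, t, z, ht, ht₁, hz, hs⟩ := mem_convexHull_iff_exists_fintype.1 h
  have : Nonempty ι := by
    by_contra hι
    simp [not_nonempty_iff.1 hι] at ht₁
  choose π hπ using hz
  have hsq (i) : singularValues M i ^ 2 = ∑ j, (√(t j) * u (π j i)) ^ 2 := by
    rw [← Pi.pow_apply, ← hs, Finset.sum_apply]
    refine Finset.sum_congr rfl fun j _ => ?_
    rw [mul_pow, Real.sq_sqrt (ht j), ← hπ]
    rfl
  choose c hc hcs using fun i => exists_sum_sq_eq_one_mul_eq (hsq i)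
  choose Q hQ hQπ using fun j => exists_unitary_conj_realDiagonal_comp ℂ (π j)
  obtain ⟨V, hV, hM⟩ := exists_mul_conjTranspose_self_eq M
  have hVV : Vᴴ * V = 1 := mem_unitaryGroup_iff'.1 hV
  obtain ⟨X, hMX, hX⟩ := exists_singularValueDecomposition hV hM
  refine ⟨ι, _, t, fun j => W * Q j * realDiagonal ℂ (c · j) * Vᴴ, fun j => Xᴴ * (Q j)ᴴ * Z, ht,
    ht₁, sum_conjTranspose_mul_realDiagonal_mul_eq_one (fun j => mul_mem hW (hQ j)) hV hc,
    fun j => ?_, fun j => ?_⟩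
  · refine l2_opNorm_mul_le_one (l2_opNorm_mul_le_one ?_ ?_) hZ
    · rw [l2_opNorm_conjTranspose]
      exact l2_opNorm_le_one_of_mul_conjTranspose_eq (fun i => by split_ifs <;> simp) hX
    · exact l2_opNorm_le_one_of_mem_unitaryGroup (Unitary.star_mem (hQ j))
  · have hscale : (c · j) * singularValues M = (√(t j) • u) ∘ π j := funext fun i => hcs i j
    calc W * Q j * realDiagonal ℂ (c · j) * Vᴴ * M * (Xᴴ * (Q j)ᴴ * Z)
        = W * (Q j * (realDiagonal ℂ (c · j) * (Vᴴ * V) *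
            (realDiagonal ℂ (singularValues M) * (X * Xᴴ))) * (Q j)ᴴ) * Z := by
          conv_lhs => rw [hMX]
          simp only [Matrix.mul_assoc]
      _ = W * realDiagonal ℂ (√(t j) • u) * Z := by
          simp only [hVV, Matrix.mul_one, hX, realDiagonal_mul_realDiagonal,
            mul_ite_eq_zero_zero_one, hscale, hQπ]

theorem exists_isLOCC_le_fidelity {a b b' : ℕ} [NeZero b'] (Φ : BipVec a b) (Ψ : BipVec a b')
    {p : Fin a → ℝ} (hp : p ∈ majorizingVectors (singularValues (coeffMatrix Φ) ^ 2)) :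
    ∃ C : BipOp a b → BipOp a b', IsLOCC C ∧
      (∑ i, √(p i) * singularValues (coeffMatrix Ψ) i) ^ 2 ≤ fidelity Ψ (C (pureState Φ)) := by
  obtain ⟨-, hp₀, hsum, hle⟩ := hp
  set s' := singularValues (coeffMatrix Ψ)
  set u : Fin a → ℝ := fun i => √(p i)
  have hu : u ^ 2 = p := funext fun i => Real.sq_sqrt (hp₀ i)
  obtain ⟨W, hW, hN⟩ := exists_mul_conjTranspose_self_eq (coeffMatrix Ψ)
  have hWW : Wᴴ * W = 1 := mem_unitaryGroup_iff'.1 hW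
  obtain ⟨Z, hNZ, hZ⟩ := exists_singularValueDecomposition hW hN
  have hmem := mem_convexHull_perm_of_partialSumsLE hle hsum.symm
    (antitone_singularValues_sq (coeffMatrix Φ))
  rw [← hu] at hmem
  obtain ⟨ι, _, t, K, Y, ht, ht₁, hK, hY, hKY⟩ := exists_measurement_mul_mul_eq hmem hW
    (l2_opNorm_le_one_of_mul_conjTranspose_eq (fun i => by split_ifs <;> simp) hZ)
  obtain ⟨C, hC, hCf⟩ := exists_isLOCC_sum_norm_trace_sq_le_fidelity hK hY
  refine ⟨C, hC, le_trans (le_of_eq ?_) (hCf Φ Ψ)⟩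
  have htrace (j) : ((coeffMatrix Ψ)ᴴ * (K j * coeffMatrix Φ * Y j)).trace =
      ((√(t j) * ∑ i, u i * s' i : ℝ) : ℂ) := by
    calc _ = (Z * Zᴴ * realDiagonal ℂ s' * (Wᴴ * W) * realDiagonal ℂ (√(t j) • u)).trace := by
          rw [hKY, ← Matrix.mul_assoc, trace_mul_comm _ Z, hNZ]
          simp only [conjTranspose_mul, conjTranspose_realDiagonal, Matrix.mul_assoc, s']
      _ = _ := by
          rw [hWW, Matrix.mul_one, hZ, realDiagonal_mul_realDiagonal, realDiagonal_mul_realDiagonal,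
            mul_comm _ s', mul_ite_eq_zero_zero_one, mul_comm, smul_mul_assoc, trace_realDiagonal,
            Finset.mul_sum]
          rfl
  simp only [htrace, Complex.norm_real, Real.norm_eq_abs, sq_abs, mul_pow, Real.sq_sqrt (ht _)]
  rw [← Finset.sum_mul, ht₁, one_mul]

end Achievability

section MaxOverlap

variable {d : ℕ} {v : Fin d → ℝ}

theorem self_mem_majorizingVectors (hv : Antitone v) (hv₀ : ∀ i, 0 ≤ v i) :
    v ∈ majorizingVectors v :=
  ⟨hv, hv₀, rfl, fun _ => le_rfl⟩

theorem isCompact_majorizingVectors (v : Fin d → ℝ) : IsCompact (majorizingVectors v) := by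
  refine (isCompact_Icc (a := (0 : Fin d → ℝ)) (b := fun _ => ∑ i, v i)).of_isClosed_subset ?_ ?_
  · simp only [majorizingVectors, Antitone, PartialSumsLE, Set.ofPred_and, Set.ofPred_forall]
    refine .inter ?_ (.inter ?_ (.inter ?_ ?_))
    · exact isClosed_iInter fun i => isClosed_iInter fun j => isClosed_iInter fun _ =>
        isClosed_le (continuous_apply _) (continuous_apply _)
    · exact isClosed_iInter fun i => isClosed_le continuous_const (continuous_apply _)
    · exact isClosed_eq (by fun_prop) continuous_const
    · exact isClosed_iInter fun k => isClosed_le continuous_const (by fun_prop)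
  · rintro p ⟨-, hp₀, hsum, -⟩
    exact ⟨hp₀, fun i =>
      (Finset.single_le_sum (fun j _ => hp₀ j) (Finset.mem_univ i)).trans_eq hsum⟩

/-- The largest squared overlap of `w` with the entrywise square root of a vector majorizing `v`.
For `v` the squared Schmidt coefficients of the initial state and `w` the Schmidt coefficients of
the target, this is the common value of the maxima to be compared. -/
def maxOverlap (v w : Fin d → ℝ) : ℝ :=
  sSup ((fun p => (∑ i, √(p i) * w i) ^ 2) '' majorizingVectors v)

theorem isGreatest_maxOverlap (hv : Antitone v) (hv₀ : ∀ i, 0 ≤ v i) (w : Fin d → ℝ) :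
    IsGreatest ((fun p => (∑ i, √(p i) * w i) ^ 2) '' majorizingVectors v) (maxOverlap v w) :=
  ((isCompact_majorizingVectors v).image (by fun_prop)).isGreatest_sSup
    (Set.Nonempty.image _ ⟨v, self_mem_majorizingVectors hv hv₀⟩)

theorem isGreatest_maxOverlap_singularValues {n : Type*} [Fintype n] (M : Matrix (Fin d) n ℂ)
    (w : Fin d → ℝ) :
    IsGreatest ((fun p => (∑ i, √(p i) * w i) ^ 2) '' majorizingVectors (singularValues M ^ 2))
      (maxOverlap (singularValues M ^ 2) w) :=
  isGreatest_maxOverlap (antitone_singularValues_sq M) (fun _ => sq_nonneg _) w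

theorem isGreatest_fidelity_isLOCC {a b b' : ℕ} [NeZero b'] (Φ : BipVec a b) (Ψ : BipVec a b') :
    IsGreatest {f : ℝ | ∃ C : BipOp a b → BipOp a b',
        IsLOCC C ∧ f = fidelity Ψ (C (pureState Φ))}
      (maxOverlap (singularValues (coeffMatrix Φ) ^ 2) (singularValues (coeffMatrix Ψ))) := by
  obtain ⟨⟨p, hp, hpmax⟩, hmax⟩ := isGreatest_maxOverlap_singularValues (coeffMatrix Φ)
    (singularValues (coeffMatrix Ψ))
  have hupper {C : BipOp a b → BipOp a b'} (hC : IsLOCC C) :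
      fidelity Ψ (C (pureState Φ)) ≤ maxOverlap _ _ :=
    let ⟨q, hq, hle⟩ := hC.isSeparable.exists_fidelity_le Φ Ψ
    hle.trans (hmax ⟨q, hq, rfl⟩)
  obtain ⟨C, hC, hle⟩ := exists_isLOCC_le_fidelity Φ Ψ hp
  refine ⟨⟨C, hC, (hpmax.ge.trans hle).antisymm (hupper hC)⟩, ?_⟩
  rintro _ ⟨C, hC, rfl⟩
  exact hupper hC

end MaxOverlap

section UnitaryMaximum

variable {𝕜 n : Type*} [RCLike 𝕜] [Fintype n] [DecidableEq n]

theorem isCompact_unitaryGroup : IsCompact (unitaryGroup n 𝕜 : Set (Matrix n n 𝕜)) := by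
  have hK : IsCompact (Set.univ.pi fun _ : n => Set.univ.pi fun _ : n =>
      Metric.closedBall (0 : 𝕜) 1) :=
    isCompact_univ_pi fun _ => isCompact_univ_pi fun _ => isCompact_closedBall 0 1
  refine IsCompact.of_isClosed_subset (X := Matrix n n 𝕜) hK ?_ ?_
  · have : (unitaryGroup n 𝕜 : Set (Matrix n n 𝕜)) = {U | U * star U = 1} :=
      Set.ext fun U => mem_unitaryGroup_iff
    rw [this]
    exact isClosed_eq (by fun_prop) continuous_const
  · intro U hU i _ j _
    simpa using entry_norm_bound_of_unitary hU i j

theorem exists_isGreatest_sq_norm_trace_mul_unitary (A : Matrix n n 𝕜) :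
    ∃ g : ℝ, IsGreatest {f : ℝ | ∃ U ∈ unitaryGroup n 𝕜, f = ‖(A * U).trace‖ ^ 2} g := by
  obtain ⟨U, hU, hmax⟩ := isCompact_unitaryGroup.exists_isMaxOn ⟨1, one_mem _⟩
    (f := fun U : Matrix n n 𝕜 => ‖(A * U).trace‖ ^ 2) (by fun_prop)
  refine ⟨_, ⟨U, hU, rfl⟩, ?_⟩
  rintro _ ⟨U', hU', rfl⟩
  exact hmax hU'

end UnitaryMaximum

section MajorizingDensities

variable {d : ℕ} {n n' : Type*} [Fintype n] [Fintype n']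

theorem sum_eigenvalues₀_eq_sum_singularValues_sq (M : Matrix (Fin d) n ℂ)
    (h : (M * Mᴴ).IsHermitian) (k : ℕ) :
    ∑ i with i.val < k, h.eigenvalues₀ i =
      ∑ i with i.val < k, (singularValues M ^ 2) i := by
  simp only [Finset.sum_filter, Pi.pow_apply, singularValues_sq_apply]
  exact (finCongr (Fintype.card_fin d)).symm.sum_comp
    (fun i => if i.val < k then h.eigenvalues₀ i else 0) |>.symm

theorem majorizes_mul_conjTranspose_iff (M : Matrix (Fin d) n ℂ) (N : Matrix (Fin d) n' ℂ) :
    Majorizes (N * Nᴴ) (M * Mᴴ) ↔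
      PartialSumsLE (singularValues M ^ 2) (singularValues N ^ 2) := by
  simp only [Majorizes, sum_eigenvalues₀_eq_sum_singularValues_sq, exists_prop, PartialSumsLE,
    isHermitian_mul_conjTranspose_self, true_and]

theorem isDensity_mul_conjTranspose_iff (M : Matrix (Fin d) n ℂ) :
    IsDensity (M * Mᴴ) ↔ ∑ i, singularValues M i ^ 2 = 1 := by
  rw [IsDensity, trace_mul_conjTranspose_self, hsNormSq_eq_sum_singularValues_sq,
    ← RCLike.ofReal_one (K := ℂ), RCLike.ofReal_inj,
    and_iff_right (posSemidef_self_mul_conjTranspose M)]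

theorem mul_conjTranspose_mem_majorizingDensities_iff {M : Matrix (Fin d) n ℂ}
    (hM : IsDensity (M * Mᴴ)) (N : Matrix (Fin d) n' ℂ) :
    N * Nᴴ ∈ majorizingDensities (M * Mᴴ) ↔
      singularValues N ^ 2 ∈ majorizingVectors (singularValues M ^ 2) := by
  rw [majorizingDensities, Set.mem_ofPred_eq, isDensity_mul_conjTranspose_iff,
    majorizes_mul_conjTranspose_iff, ← (isDensity_mul_conjTranspose_iff M).1 hM]
  exact ⟨fun h => ⟨antitone_singularValues_sq N, fun _ => sq_nonneg _, h⟩, fun h => h.2.2⟩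

theorem conjTranspose_cfcSqrt (A : Matrix (Fin d) (Fin d) ℂ) : (CFC.sqrt A)ᴴ = CFC.sqrt A :=
  (nonneg_iff_posSemidef.1 (CFC.sqrt_nonneg A)).isHermitian

theorem cfcSqrt_mul_conjTranspose_cfcSqrt {A : Matrix (Fin d) (Fin d) ℂ} (hA : A.PosSemidef) :
    CFC.sqrt A * (CFC.sqrt A)ᴴ = A := by
  rw [conjTranspose_cfcSqrt, CFC.sqrt_mul_sqrt_self A hA.nonneg]

theorem norm_trace_sqrt_mul_sqrt_mul_le (A B : Matrix (Fin d) (Fin d) ℂ)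
    {U : Matrix (Fin d) (Fin d) ℂ} (hU : U ∈ unitaryGroup (Fin d) ℂ) :
    ‖(CFC.sqrt A * CFC.sqrt B * U).trace‖ ≤
      singularValues (CFC.sqrt A) ⬝ᵥ singularValues (CFC.sqrt B) := by
  have hUU : U * Uᴴ = 1 := mem_unitaryGroup_iff.1 hU
  have hB : singularValues (CFC.sqrt B * U) = singularValues (CFC.sqrt B) := by
    refine singularValues_congr ?_
    rw [conjTranspose_mul, Matrix.mul_assoc, ← Matrix.mul_assoc U, hUU, Matrix.one_mul]
  have := norm_trace_conjTranspose_mul_le (CFC.sqrt B * U) (CFC.sqrt A)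
  rwa [hB, conjTranspose_cfcSqrt, ← Matrix.mul_assoc] at this

theorem sq_norm_trace_sqrt_mul_sqrt_mul_le_maxOverlap {M : Matrix (Fin d) n ℂ}
    (hM : IsDensity (M * Mᴴ)) (N : Matrix (Fin d) n' ℂ) {ρ' U : Matrix (Fin d) (Fin d) ℂ}
    (hρ' : ρ' ∈ majorizingDensities (M * Mᴴ)) (hU : U ∈ unitaryGroup (Fin d) ℂ) :
    ‖(CFC.sqrt ρ' * CFC.sqrt (N * Nᴴ) * U).trace‖ ^ 2 ≤
      maxOverlap (singularValues M ^ 2) (singularValues N) := by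
  have hsqrt := cfcSqrt_mul_conjTranspose_cfcSqrt hρ'.1.1
  have hN : singularValues (CFC.sqrt (N * Nᴴ)) = singularValues N :=
    singularValues_congr
      (cfcSqrt_mul_conjTranspose_cfcSqrt (posSemidef_self_mul_conjTranspose N))
  rw [← hsqrt, mul_conjTranspose_mem_majorizingDensities_iff hM] at hρ'
  refine le_trans ?_ ((isGreatest_maxOverlap_singularValues M _).2 ⟨_, hρ', rfl⟩)
  refine pow_le_pow_left₀ (norm_nonneg _)
    ((norm_trace_sqrt_mul_sqrt_mul_le ρ' _ hU).trans_eq ?_) 2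
  simp only [hN, dotProduct, Pi.pow_apply, Real.sqrt_sq (singularValues_nonneg _ _)]

theorem cfcSqrt_conj_realDiagonal {V : Matrix (Fin d) (Fin d) ℂ} (hV : V ∈ unitaryGroup (Fin d) ℂ)
    {s : Fin d → ℝ} (hs : ∀ i, 0 ≤ s i) :
    CFC.sqrt (V * realDiagonal ℂ (s ^ 2) * Vᴴ) = V * realDiagonal ℂ s * Vᴴ := by
  have hVV : Vᴴ * V = 1 := mem_unitaryGroup_iff'.1 hV
  refine CFC.sqrt_unique ?_ ((posSemidef_realDiagonal hs).mul_mul_conjTranspose_same V).nonneg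
  calc V * realDiagonal ℂ s * Vᴴ * (V * realDiagonal ℂ s * Vᴴ)
      = V * (realDiagonal ℂ s * (Vᴴ * V) * realDiagonal ℂ s) * Vᴴ := by
        simp only [Matrix.mul_assoc]
    _ = V * realDiagonal ℂ (s ^ 2) * Vᴴ := by
        rw [hVV, Matrix.mul_one, realDiagonal_mul_realDiagonal, sq]

theorem trace_conj_realDiagonal_mul_conj_realDiagonal {V : Matrix (Fin d) (Fin d) ℂ}
    (hV : V ∈ unitaryGroup (Fin d) ℂ) (r s : Fin d → ℝ) :
    (V * realDiagonal ℂ r * Vᴴ * (V * realDiagonal ℂ s * Vᴴ)).trace =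
      ((∑ i, r i * s i : ℝ) : ℂ) := by
  have hVV : Vᴴ * V = 1 := mem_unitaryGroup_iff'.1 hV
  calc (V * realDiagonal ℂ r * Vᴴ * (V * realDiagonal ℂ s * Vᴴ)).trace
      = (Vᴴ * V * realDiagonal ℂ r * (Vᴴ * V) * realDiagonal ℂ s).trace := by
        rw [← Matrix.mul_assoc _ _ Vᴴ, trace_mul_comm _ Vᴴ]
        simp only [Matrix.mul_assoc]
    _ = ((∑ i, r i * s i : ℝ) : ℂ) := by
        rw [hVV, Matrix.one_mul, Matrix.mul_one, realDiagonal_mul_realDiagonal, trace_realDiagonal]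
        rfl

/-- The optimal `ρ'` has the same eigenvectors as `N * Nᴴ`, in the same order. -/
theorem exists_trace_sqrt_mul_sqrt_sq_eq_maxOverlap {M : Matrix (Fin d) n ℂ}
    (hM : IsDensity (M * Mᴴ)) (N : Matrix (Fin d) n' ℂ) :
    ∃ ρ' ∈ majorizingDensities (M * Mᴴ), ∃ x : ℝ,
      (CFC.sqrt ρ' * CFC.sqrt (N * Nᴴ)).trace = x ∧
        x ^ 2 = maxOverlap (singularValues M ^ 2) (singularValues N) := by
  obtain ⟨p, hp, hmax⟩ := (isGreatest_maxOverlap_singularValues M (singularValues N)).1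
  obtain ⟨V, hV, hN⟩ := exists_mul_conjTranspose_self_eq N
  set s : Fin d → ℝ := fun i => √(p i)
  have hs : s ^ 2 = p := funext fun i => Real.sq_sqrt (hp.2.1 i)
  set ρ' := V * realDiagonal ℂ (s ^ 2) * Vᴴ
  have hsqrt : CFC.sqrt ρ' = V * realDiagonal ℂ s * Vᴴ :=
    cfcSqrt_conj_realDiagonal hV fun i => Real.sqrt_nonneg _
  have hρ' : CFC.sqrt ρ' * (CFC.sqrt ρ')ᴴ = ρ' :=
    cfcSqrt_mul_conjTranspose_cfcSqrt ((posSemidef_realDiagonal fun i =>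
      sq_nonneg (s i)).mul_mul_conjTranspose_same V)
  have hvalues : singularValues (CFC.sqrt ρ') = s :=
    singularValues_eq hV (fun i j hij => Real.sqrt_le_sqrt (hp.1 hij))
      (fun i => Real.sqrt_nonneg _) hρ'
  refine ⟨ρ', ?_, _, ?_, hmax⟩
  · rwa [← hρ', mul_conjTranspose_mem_majorizingDensities_iff hM, hvalues, hs]
  · rw [hsqrt, hN, cfcSqrt_conj_realDiagonal hV (singularValues_nonneg N),
      trace_conj_realDiagonal_mul_conj_realDiagonal hV]

theorem exists_isGreatest_image_majorizingDensities {M : Matrix (Fin d) n ℂ}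
    (hM : IsDensity (M * Mᴴ)) (N : Matrix (Fin d) n' ℂ) :
    ∃ g : Matrix (Fin d) (Fin d) ℂ → ℝ,
      (∀ ρ' ∈ majorizingDensities (M * Mᴴ), IsGreatest {f : ℝ | ∃ U ∈ unitaryGroup (Fin d) ℂ,
        f = ‖(CFC.sqrt ρ' * CFC.sqrt (N * Nᴴ) * U).trace‖ ^ 2} (g ρ')) ∧
      IsGreatest (g '' majorizingDensities (M * Mᴴ))
        (maxOverlap (singularValues M ^ 2) (singularValues N)) := by
  choose g hg using fun ρ' : Matrix (Fin d) (Fin d) ℂ =>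
    exists_isGreatest_sq_norm_trace_mul_unitary (CFC.sqrt ρ' * CFC.sqrt (N * Nᴴ))
  have hupper {ρ'} (hρ' : ρ' ∈ majorizingDensities (M * Mᴴ)) :
      g ρ' ≤ maxOverlap (singularValues M ^ 2) (singularValues N) := by
    obtain ⟨U, hU, hgU⟩ := (hg ρ').1
    exact hgU.trans_le (sq_norm_trace_sqrt_mul_sqrt_mul_le_maxOverlap hM N hρ' hU)
  obtain ⟨ρ', hρ', x, hx, hmax⟩ := exists_trace_sqrt_mul_sqrt_sq_eq_maxOverlap hM N
  refine ⟨g, fun ρ' _ => hg ρ', ⟨ρ', hρ', (hupper hρ').antisymm ((hg ρ').2 ⟨1, one_mem _, ?_⟩)⟩, ?_⟩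
  · rw [Matrix.mul_one, hx, Complex.norm_real, Real.norm_eq_abs, sq_abs, hmax]
  · rintro _ ⟨ρ', hρ', rfl⟩
    exact hupper hρ'

end MajorizingDensities

section MaximallyEntangled

variable {d : ℕ}

theorem cfcSqrt_eq_smul_of_isStarProjection_smul {c : ℝ} (hc : 0 < c)
    {σ : Matrix (Fin d) (Fin d) ℂ} (h : IsStarProjection ((c : ℂ) • σ)) :
    CFC.sqrt σ = ((√c : ℝ) : ℂ) • σ := by
  have hsq : ((√c : ℝ) : ℂ) * ((√c : ℝ) : ℂ) = c := by
    exact_mod_cast Real.mul_self_sqrt hc.le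
  have hc' : (c : ℂ) ≠ 0 := by exact_mod_cast hc.ne'
  refine CFC.sqrt_unique ?_ ?_
  · have hidem := h.isIdempotentElem.eq
    rw [smul_mul_smul_comm, ← smul_smul] at hidem
    rw [smul_mul_smul_comm, hsq]
    exact smul_right_injective _ hc' hidem
  · have hnonneg : 0 ≤ ((√c / c : ℝ) : ℂ) • ((c : ℂ) • σ) :=
      smul_nonneg (by exact_mod_cast (by positivity : 0 ≤ √c / c)) h.nonneg
    rwa [smul_smul, Complex.ofReal_div, div_mul_cancel₀ _ hc'] at hnonneg

theorem re_trace_mul_smul_sq_div {c : ℝ} (hc : 0 < c) {σ : Matrix (Fin d) (Fin d) ℂ}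
    (h : IsStarProjection ((c : ℂ) • σ)) (A : Matrix (Fin d) (Fin d) ℂ) :
    (A * ((c : ℂ) • σ)).trace.re ^ 2 / c = (A * CFC.sqrt σ).trace.re ^ 2 := by
  rw [cfcSqrt_eq_smul_of_isStarProjection_smul hc h, Matrix.mul_smul, Matrix.mul_smul, trace_smul,
    trace_smul, smul_eq_mul, smul_eq_mul, Complex.re_ofReal_mul, Complex.re_ofReal_mul, mul_pow,
    mul_pow, Real.sq_sqrt hc.le]
  field_simp

theorem isGreatest_re_trace_sqrt_mul_smul_sq_div {n n' : Type*} [Fintype n] [Fintype n']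
    {M : Matrix (Fin d) n ℂ} (hM : IsDensity (M * Mᴴ)) {N : Matrix (Fin d) n' ℂ} {c : ℝ}
    (hc : 0 < c) (hN : IsStarProjection ((c : ℂ) • (N * Nᴴ))) :
    IsGreatest {f : ℝ | ∃ ρ' ∈ majorizingDensities (M * Mᴴ),
        f = (CFC.sqrt ρ' * ((c : ℂ) • (N * Nᴴ))).trace.re ^ 2 / c}
      (maxOverlap (singularValues M ^ 2) (singularValues N)) := by
  simp only [re_trace_mul_smul_sq_div hc hN]
  obtain ⟨ρ', hρ', x, hx, hmax⟩ := exists_trace_sqrt_mul_sqrt_sq_eq_maxOverlap hM N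
  refine ⟨⟨ρ', hρ', by rw [hx, Complex.ofReal_re, hmax]⟩, ?_⟩
  rintro _ ⟨ρ', hρ', rfl⟩
  have hle := sq_norm_trace_sqrt_mul_sqrt_mul_le_maxOverlap hM N hρ' (one_mem _)
  rw [Matrix.mul_one] at hle
  exact (sq_le_sq' (neg_le_of_abs_le (Complex.abs_re_le_norm _)) (Complex.re_le_norm _)).trans hle

end MaximallyEntangled

theorem isDensity_coeffMatrix_mul_conjTranspose {a b : ℕ} {Φ : BipVec a b} (hΦ : ‖Φ‖ = 1) :
    IsDensity (coeffMatrix Φ * (coeffMatrix Φ)ᴴ) := by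
  rw [isDensity_mul_conjTranspose_iff, ← hsNormSq_eq_sum_singularValues_sq, hsNormSq_coeffMatrix,
    hΦ, one_pow]

end LOCCFidelity

end

open LOCCFidelity in
theorem mainTheorem4_general {a b b' : ℕ} [NeZero b'] (Φ : BipVec a b) (Ψ : BipVec a b')
    (hΦ : ‖Φ‖ = 1) :
    ∃ F : ℝ,
      IsGreatest {f : ℝ | ∃ C : BipOp a b → BipOp a b',
        IsLOCC C ∧ f = fidelity Ψ (C (pureState Φ))} F ∧
      (∃ g : Matrix (Fin a) (Fin a) ℂ → ℝ,
        (∀ ρ' ∈ majorizingDensities (reducedDensity Φ),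
          IsGreatest {f : ℝ | ∃ U ∈ Matrix.unitaryGroup (Fin a) ℂ,
            f = ‖(CFC.sqrt ρ' * CFC.sqrt (reducedDensity Ψ) * U).trace‖ ^ 2} (g ρ')) ∧
        IsGreatest (g '' majorizingDensities (reducedDensity Φ)) F) ∧
      (∀ L : ℕ, IsMaximallyEntangled Ψ L →
        IsGreatest {f : ℝ | ∃ ρ' ∈ majorizingDensities (reducedDensity Φ),
          f = (CFC.sqrt ρ' * ((L : ℂ) • reducedDensity Ψ)).trace.re ^ 2 / L} F) := by
  have hρ := isDensity_coeffMatrix_mul_conjTranspose hΦ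
  refine ⟨_, isGreatest_fidelity_isLOCC Φ Ψ, ?_, fun L hL => ?_⟩
  · simpa only [reducedDensity_eq] using
      exists_isGreatest_image_majorizingDensities hρ (coeffMatrix Ψ)
  · obtain ⟨hL₀, hproj, -⟩ := hL
    rw [← Complex.ofReal_natCast] at hproj ⊢
    simp only [reducedDensity_eq] at hproj ⊢
    exact isGreatest_re_trace_sqrt_mul_smul_sq_div hρ (Nat.cast_pos.2 hL₀) hproj

theorem mainTheorem4 {dA dB : ℕ} (Φ Ψ : LOCCFidelity.BipVec dA dB) (hΦ : ‖Φ‖ = 1) (hΨ : ‖Ψ‖ = 1)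
    (ρ σ : Matrix (Fin dA) (Fin dA) ℂ)
    (hρ : ρ = LOCCFidelity.reducedDensity Φ) (hσ : σ = LOCCFidelity.reducedDensity Ψ) :
    ∃ F : ℝ,
      -- `F` is the maximum over LOCC operations `C` of `⟨Ψ| C(|Φ⟩⟨Φ|) |Ψ⟩`
      IsGreatest
        {f : ℝ | ∃ C : LOCCFidelity.BipOp dA dB → LOCCFidelity.BipOp dA dB,
          LOCCFidelity.IsLOCC C ∧ f = LOCCFidelity.fidelity Ψ (C (LOCCFidelity.pureState Φ))} F ∧
      -- `F` is the maximum over `ρ' ⪰ ρ` of `g ρ'`, the maximum over unitaries `U`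
      (∃ g : Matrix (Fin dA) (Fin dA) ℂ → ℝ,
        (∀ ρ' ∈ LOCCFidelity.majorizingDensities ρ,
          IsGreatest
            {f : ℝ | ∃ U ∈ Matrix.unitaryGroup (Fin dA) ℂ,
              f = ‖(CFC.sqrt ρ' * CFC.sqrt σ * U).trace‖ ^ 2} (g ρ')) ∧
        IsGreatest (g '' LOCCFidelity.majorizingDensities ρ) F) ∧
      -- the case of a maximally entangled target of size `L`, with `T = L • σ`
      (∀ L : ℕ, LOCCFidelity.IsMaximallyEntangled Ψ L →
        IsGreatest
          {f : ℝ | ∃ ρ' ∈ LOCCFidelity.majorizingDensities ρ,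
            f = (CFC.sqrt ρ' * ((L : ℂ) • σ)).trace.re ^ 2 / L} F) := by
  have : NeZero dB := ⟨by
    rintro rfl
    simp [Subsingleton.elim Φ 0] at hΦ⟩
  subst hρ hσ
  exact mainTheorem4_general Φ Ψ hΦ
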